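/- Setting. Let $X\subset\mathbb R$ be a nonempty interval. A lattice $\mathcal L=\bigcup_{k\in\mathbb Z}\mathcal L_k$ on $X$ consists of generations $\mathcal L_k$, each a family of disjoint nontrivial bounded intervals $[a,b)$ covering $X$, such that every $I\in\mathcal L_k$ is a finite union of intervals of $\mathcal L_{k+1}$ (possibly of only one). The rank of $I\in\mathcal L$ is the largest $k$ with $I\in\mathcal L_k$; if $I$ has rank $k$, its children are the $J\in\mathcal L_{k+1}$ with $J\subset I$ (an interval belonging to all late generations has no children). Let $\mathcal T$ be the set of all intervals of the form $\bigcup_{k\in\mathbb Z} I_k$ with $I_k\in\mathcal L_k$, $I_k\subset I_{k-1}$, that have finite length. Scalars are real or complex. A formal martingale difference decomposition $f$ consists of functions $\Delta_I f$, $I\in\mathcal L$, where $\Delta_I f$ vanishes off $I$, is constant on each child of $I$ and satisfies $\int\Delta_I f\,dx=0$ ($\Delta_I f=0$ if $I$ has no children), and of functions $E_I f$, $I\in\mathcal T$, where $E_I f$ is a multiple of $\mathbf 1_I$. For $1<q<\infty$ put $$\|f\|_{\widetilde{\mathcal H}^1_q}=\int_X\Bigl(\sum_{I\in\mathcal L}|\Delta_I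 f|^q+\sum_{I\in\mathcal T}|E_I f|^q\Bigr)^{1/q}dx .$$ The space $\widetilde{\mathcal H}^1_q$ consists of all $f$ for which this is finite, and $\mathcal H^1_q$ is its subspace given by $E_I f=0$ for all $I\in\mathcal T$. For a child $J$ of $I$ let $x_J(f)$ be the value of $\Delta_I f$ on $J$, and put $x_J(f)=0$ if $J\in\mathcal L$ is not a child of any interval. Let $$\|f\|_{\mathcal{BMO}_q}=\sup_{J\in\mathcal L}\Bigl(\frac1{|J|}\int_J\sum_{I\in\mathcal L,\ I\subset J}|x_I(f)|^q\,\mathbf 1_I\,dx\Bigr)^{1/q},\qquad \|f\|_{\mathcal{BMO}^\sim_q}=\max\Bigl(\|f\|_{\mathcal{BMO}_q},\ \sup_{I\in\mathcal T}\|E_I f\|_\infty\Bigr).$$ The space $\mathcal{BMO}^\sim_q$ consists of all $f$ for which the last norm is finite, and $\mathcal{BMO}_q$ is its subspace given by $E_I f=0$ for all $I\in\mathcal T$. Theorem ($H^1$–BMO duality). Let $1<q<\infty$ and $1/q+1/q'=1$. The dual of $\mathcal H^1_q$ is $\mathcal{BMO}_{q'}$, and the dual of $\widetilde{\mathcal H}^1_q$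 is $\mathcal{BMO}^\sim_{q'}$, with respect to the bilinear pairing $$\langle f,g\rangle=\sum_{I\in\mathcal L}\int\Delta_I f\,\Delta_I g\,dx+\sum_{I\in\mathcal T}\int E_I f\,E_I g\,dx .$$ That is: for $f\in\mathcal H^1_q$ and $g\in\mathcal{BMO}_{q'}$ (respectively $f\in\widetilde{\mathcal H}^1_q$ and $g\in\mathcal{BMO}^\sim_{q'}$) the series converge unconditionally, and $g\mapsto\langle\cdot,g\rangle$ is a linear bijection of $\mathcal{BMO}_{q'}$ onto $(\mathcal H^1_q)^*$ (respectively of $\mathcal{BMO}^\sim_{q'}$ onto $(\widetilde{\mathcal H}^1_q)^*$) that is bounded together with its inverse, with $$C^{-1}\|g\|\le\|\langle\cdot,g\rangle\|\le C\|g\|,$$ where the constant $C$ depends only on $q$. -/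

import Mathlib

open MeasureTheory Set
open scoped ENNReal

noncomputable section

namespace MartingaleBMO

/-! ### Lattices of intervals -/

/-- A lattice of intervals of `X`: generations `gen k`, `k ∈ ℤ`, each a family of pairwise disjoint
nontrivial bounded intervals `[a, b)` covering `X`, such that every interval of `gen k` is a finite
union of intervals of `gen (k + 1)` (possibly of only one interval). -/
structure IntervalLattice (X : Set ℝ) where
  gen : ℤ → Set (Set ℝ)
  isIco : ∀ k, ∀ I ∈ gen k, ∃ a b : ℝ, a < b ∧ I = Ico a b
  disjoint : ∀ k, (gen k).PairwiseDisjoint id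
  cover : ∀ k, ⋃₀ gen k = X
  refine : ∀ k, ∀ I ∈ gen k, ∃ F : Set (Set ℝ), F.Finite ∧ F ⊆ gen (k + 1) ∧ ⋃₀ F = I

namespace IntervalLattice

variable {X : Set ℝ} (L : IntervalLattice X)

/-- The intervals of the lattice. -/
abbrev Cell : Type := {I : Set ℝ // ∃ k, I ∈ L.gen k}

/-- The rank of `I` is `k`: the largest `k` with `I ∈ gen k`. -/
def HasRank (I : Set ℝ) (k : ℤ) : Prop := IsGreatest {m : ℤ | I ∈ L.gen m} k

/-- `J` is a child of `I`: it lies in the generation that follows the rank of `I`, and `J ⊆ I`.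
An interval that belongs to all late generations has no rank and no children. -/
def IsChild (J I : Set ℝ) : Prop := ∃ k : ℤ, L.HasRank I k ∧ J ∈ L.gen (k + 1) ∧ J ⊆ I

/-- The intervals `⋃ k, I k` with `I k ∈ gen k` and `I k ⊆ I (k - 1)`; these are the atoms of the
tail σ-algebra `⋂ k, σ(gen k)`. -/
def IsTop (I : Set ℝ) : Prop :=
  ∃ c : ℤ → Set ℝ, (∀ k, c k ∈ L.gen k) ∧ (∀ k, c k ⊆ c (k - 1)) ∧ I = ⋃ k, c k

/-- The atoms of the tail σ-algebra that have finite length. -/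
abbrev TopFin : Type := {I : Set ℝ // L.IsTop I ∧ volume I < ∞}

variable {L}

lemma eq_of_mem {k : ℤ} {I J : Set ℝ} (hI : I ∈ L.gen k) (hJ : J ∈ L.gen k) {x : ℝ}
    (hxI : x ∈ I) (hxJ : x ∈ J) : I = J := by
  by_contra h
  exact Set.disjoint_left.1 (L.disjoint k hI hJ h) hxI hxJ

lemma exists_succ_mem {k : ℤ} {I : Set ℝ} (hI : I ∈ L.gen k) {x : ℝ} (hx : x ∈ I) :
    ∃ J ∈ L.gen (k + 1), J ⊆ I ∧ x ∈ J := by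
  obtain ⟨F, -, hF, rfl⟩ := L.refine k I hI
  obtain ⟨J, hJ, hxJ⟩ := hx
  exact ⟨J, hF hJ, subset_sUnion_of_mem hJ, hxJ⟩

lemma subset_of_mem {k : ℤ} (n : ℕ) {I J : Set ℝ} (hI : I ∈ L.gen k) (hJ : J ∈ L.gen (k + n))
    {x : ℝ} (hxI : x ∈ I) (hxJ : x ∈ J) : J ⊆ I := by
  induction n generalizing k I with
  | zero =>
    rw [eq_of_mem hI (by simpa using hJ) hxI hxJ]
  | succ n ih =>
    obtain ⟨K, hK, hKI, hxK⟩ := exists_succ_mem hI hxI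
    refine (ih hK ?_ hxK).trans hKI
    convert hJ using 2
    push_cast
    ring

lemma subset_of_le {k l : ℤ} (hkl : k ≤ l) {I J : Set ℝ} (hI : I ∈ L.gen k) (hJ : J ∈ L.gen l)
    {x : ℝ} (hxI : x ∈ I) (hxJ : x ∈ J) : J ⊆ I := by
  obtain ⟨n, rfl⟩ := Int.le.dest hkl
  exact subset_of_mem n hI hJ hxI hxJ

lemma cell_data (J : L.Cell) : ∃ a b : ℝ, a < b ∧ J.1 = Ico a b := by
  obtain ⟨k, hk⟩ := J.2
  exact L.isIco k _ hk

lemma cell_measurable (J : L.Cell) : MeasurableSet J.1 := by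
  obtain ⟨a, b, -, h⟩ := cell_data J
  rw [h]; exact measurableSet_Ico

lemma cell_volume_pos (J : L.Cell) : 0 < volume J.1 := by
  obtain ⟨a, b, hab, h⟩ := cell_data J
  rw [h]; simpa using hab

lemma cell_volume_ne_top (J : L.Cell) : volume J.1 ≠ ∞ := by
  obtain ⟨a, b, hab, h⟩ := cell_data J
  rw [h]; simp

lemma cell_sInf_mem (J : L.Cell) : sInf J.1 ∈ J.1 := by
  obtain ⟨a, b, hab, h⟩ := cell_data J
  rw [h, csInf_Ico hab]; exact ⟨le_rfl, hab⟩

lemma IsChild.cell {I J : Set ℝ} (h : L.IsChild J I) : ∃ k, J ∈ L.gen k := by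
  obtain ⟨k, -, h, -⟩ := h
  exact ⟨_, h⟩

/-- An interval is a child of at most one interval. -/
lemma parent_unique {I I' J : Set ℝ} (h : L.IsChild J I) (h' : L.IsChild J I') : I = I' := by
  obtain ⟨x, hx⟩ : J.Nonempty := ⟨_, cell_sInf_mem ⟨J, h.cell⟩⟩
  have key : ∀ {I I' : Set ℝ} {k k' : ℤ}, L.HasRank I k → J ∈ L.gen (k + 1) → J ⊆ I →
      L.HasRank I' k' → J ⊆ I' → J ∈ L.gen (k' + 1) → ¬ k < k' := by
    intro I I' k k' _ h2 _ h1' h3' h2' hlt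
    have hsub : I' ⊆ J := subset_of_le (by omega) h2 h1'.1 hx (h3' hx)
    have heq : I' = J := subset_antisymm hsub h3'
    have hle := h1'.2 (show k' + 1 ∈ {m : ℤ | I' ∈ L.gen m} by rw [heq]; exact h2')
    omega
  obtain ⟨k, h1, h2, h3⟩ := h
  obtain ⟨k', h1', h2', h3'⟩ := h'
  have hk : k = k' := le_antisymm (not_lt.1 (key h1' h2' h3' h1 h3 h2))
    (not_lt.1 (key h1 h2 h3 h1' h3' h2'))
  subst hk
  exact eq_of_mem h1.1 h1'.1 (h3 hx) (h3' hx)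

lemma gen_countable (k : ℤ) : (L.gen k).Countable := by
  refine Set.PairwiseDisjoint.countable_of_nonempty_interior (L.disjoint k) fun I hI => ?_
  obtain ⟨a, b, hab, rfl⟩ := L.isIco k I hI
  simpa using hab

instance : Countable L.Cell := by
  have : {I : Set ℝ | ∃ k, I ∈ L.gen k} = ⋃ k, L.gen k := by ext; simp
  have h : {I : Set ℝ | ∃ k, I ∈ L.gen k}.Countable := by
    rw [this]; exact countable_iUnion gen_countable
  exact h.to_subtype

lemma IsTop.subset_of_le {c : ℤ → Set ℝ} (hc : ∀ k, c k ⊆ c (k - 1)) {k l : ℤ} (h : k ≤ l) :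
    c l ⊆ c k := by
  obtain ⟨n, rfl⟩ := Int.le.dest h
  clear h
  induction n with
  | zero => simp
  | succ n ih =>
    refine Subset.trans ?_ ih
    have := hc (k + (n + 1 : ℕ))
    convert this using 2
    push_cast
    ring

lemma IsTop.eq_of_mem {I J : Set ℝ} (hI : L.IsTop I) (hJ : L.IsTop J) {x : ℝ} (hxI : x ∈ I)
    (hxJ : x ∈ J) : I = J := by
  have key : ∀ {I J : Set ℝ}, L.IsTop I → L.IsTop J → x ∈ I → x ∈ J → I ⊆ J := by
    rintro I J ⟨c, hc, hm, rfl⟩ ⟨d, hd, hn, rfl⟩ hxI hxJ y hy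
    obtain ⟨k, hk⟩ := mem_iUnion.1 hxI
    obtain ⟨l, hl⟩ := mem_iUnion.1 hxJ
    obtain ⟨m, hy⟩ := mem_iUnion.1 hy
    let n := min (min k l) m
    have h1 : c n = d n := IntervalLattice.eq_of_mem (hc n) (hd n)
      (IsTop.subset_of_le hm (show n ≤ k by omega) hk)
      (IsTop.subset_of_le hn (show n ≤ l by omega) hl)
    have h2 := IsTop.subset_of_le hm (show n ≤ m by omega) hy
    rw [h1] at h2
    exact mem_iUnion.2 ⟨n, h2⟩
  exact subset_antisymm (key hI hJ hxI hxJ) (key hJ hI hxJ hxI)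

lemma IsTop.measurable {I : Set ℝ} (hI : L.IsTop I) : MeasurableSet I := by
  obtain ⟨c, hc, -, rfl⟩ := hI
  exact MeasurableSet.iUnion fun k => cell_measurable ⟨c k, k, hc k⟩

lemma IsTop.exists_cell {I : Set ℝ} (hI : L.IsTop I) : ∃ J : L.Cell, J.1 ⊆ I := by
  obtain ⟨c, hc, -, rfl⟩ := hI
  exact ⟨⟨c 0, 0, hc 0⟩, subset_iUnion c 0⟩

instance : Countable L.TopFin := by
  have h : {I : Set ℝ | L.IsTop I ∧ volume I < ∞}.Countable := by
    refine Set.PairwiseDisjoint.countable_of_nonempty_interior (s := id) ?_ ?_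
    · intro I hI J hJ hne
      refine Set.disjoint_left.2 fun x hx hy => hne (IsTop.eq_of_mem hI.1 hJ.1 hx hy)
    · intro I hI
      obtain ⟨J, hJ⟩ := hI.1.exists_cell
      obtain ⟨a, b, hab, h⟩ := cell_data J
      refine Set.Nonempty.mono (interior_mono hJ) ?_
      rw [h]; simpa using hab
  exact h.to_subtype

end IntervalLattice

/-! ### Formal martingale difference decompositions -/

variable (𝕜 : Type*) [RCLike 𝕜] {X : Set ℝ} (L : IntervalLattice X)

/-- The possible martingale differences on `I`: functions that are constant on each child of `I`,
vanish off the union of the children of `I` (that is, off `I`; if `I` has no children, only `0`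
remains), and have integral `0`. Integrability is automatic, as `I` has finitely many children. -/
def diffSpace (I : Set ℝ) : Submodule 𝕜 (ℝ → 𝕜) where
  carrier := {h | (∀ J, L.IsChild J I → ∀ x ∈ J, ∀ y ∈ J, h x = h y) ∧
    (∀ x, (∀ J, L.IsChild J I → x ∉ J) → h x = 0) ∧ Integrable h ∧ ∫ x, h x = 0}
  zero_mem' := by simp
  add_mem' := by
    rintro f g ⟨hf, hf0, hfi, hfz⟩ ⟨hg, hg0, hgi, hgz⟩
    refine ⟨fun J hJ x hx y hy => ?_, fun x hx => ?_, hfi.add hgi, ?_⟩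
    · simp [hf J hJ x hx y hy, hg J hJ x hx y hy]
    · simp [hf0 x hx, hg0 x hx]
    · simp only [Pi.add_apply]
      rw [integral_add hfi hgi, hfz, hgz, add_zero]
  smul_mem' := by
    rintro c f ⟨hf, hf0, hfi, hfz⟩
    refine ⟨fun J hJ x hx y hy => ?_, fun x hx => ?_, hfi.smul c, ?_⟩
    · simp [hf J hJ x hx y hy]
    · simp [hf0 x hx]
    · simp only [Pi.smul_apply]
      rw [integral_smul, hfz, smul_zero]

/-- The multiples of the indicator function of `I`. -/
def meanSpace (I : Set ℝ) : Submodule 𝕜 (ℝ → 𝕜) where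
  carrier := {h | ∃ c : 𝕜, h = I.indicator fun _ => c}
  zero_mem' := ⟨0, by ext; simp⟩
  add_mem' := by
    rintro _ _ ⟨c, rfl⟩ ⟨d, rfl⟩
    exact ⟨c + d, by ext x; by_cases h : x ∈ I <;> simp [h]⟩
  smul_mem' := by
    rintro a _ ⟨c, rfl⟩
    exact ⟨a • c, by ext x; by_cases h : x ∈ I <;> simp [h]⟩

/-- An (extended) formal martingale difference decomposition
`f = ∑_I Δ_I f + ∑_{I top, |I| < ∞} E_I f`: an arbitrary family of martingale differences `Δ_I f`,
one for each interval of the lattice, and an arbitrary family of multiples `E_I f` of the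
indicators of the tail atoms of finite length. -/
def Formal : Type _ :=
  (∀ I : L.Cell, diffSpace 𝕜 L I.1) × (∀ I : L.TopFin, meanSpace 𝕜 I.1)

instance : AddCommGroup (Formal 𝕜 L) :=
  inferInstanceAs (AddCommGroup
    ((∀ I : L.Cell, diffSpace 𝕜 L I.1) × (∀ I : L.TopFin, meanSpace 𝕜 I.1)))

instance : Module 𝕜 (Formal 𝕜 L) :=
  inferInstanceAs (Module 𝕜
    ((∀ I : L.Cell, diffSpace 𝕜 L I.1) × (∀ I : L.TopFin, meanSpace 𝕜 I.1)))

variable {𝕜 L}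

namespace Formal

/-- The martingale difference `Δ_I f`. -/
def diff (f : Formal 𝕜 L) (I : L.Cell) : ℝ → 𝕜 := (f.1 I).1

/-- The mean term `E_I f`. -/
def mean (f : Formal 𝕜 L) (I : L.TopFin) : ℝ → 𝕜 := (f.2 I).1

@[simp] lemma diff_add (f g : Formal 𝕜 L) (I : L.Cell) : (f + g).diff I = f.diff I + g.diff I := rfl
@[simp] lemma mean_add (f g : Formal 𝕜 L) (I : L.TopFin) :
    (f + g).mean I = f.mean I + g.mean I := rfl
@[simp] lemma diff_smul (c : 𝕜) (f : Formal 𝕜 L) (I : L.Cell) : (c • f).diff I = c • f.diff I := rfl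
@[simp] lemma mean_smul (c : 𝕜) (f : Formal 𝕜 L) (I : L.TopFin) :
    (c • f).mean I = c • f.mean I := rfl
@[simp] lemma diff_zero (I : L.Cell) : (0 : Formal 𝕜 L).diff I = 0 := rfl
@[simp] lemma mean_zero (I : L.TopFin) : (0 : Formal 𝕜 L).mean I = 0 := rfl

lemma ext {f g : Formal 𝕜 L} (h : ∀ I, f.diff I = g.diff I) (h' : ∀ I, f.mean I = g.mean I) :
    f = g :=
  Prod.ext (funext fun I => Subtype.ext (h I)) (funext fun I => Subtype.ext (h' I))

lemma measurable_diff (f : Formal 𝕜 L) (I : L.Cell) : AEMeasurable (f.diff I) :=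
  (f.1 I).2.2.2.1.aemeasurable

lemma measurable_mean (f : Formal 𝕜 L) (I : L.TopFin) : Measurable (f.mean I) := by
  obtain ⟨c, hc⟩ := (f.2 I).2
  rw [mean, hc]
  exact measurable_const.indicator I.2.1.measurable

open Classical in
/-- The number sequence attached to `f`: for a child `J` of `I`, the entry at `J` is the value of
`Δ_I f` on `J` (read off at the left end point); the entry is `0` if `J` is nobody's child. -/
def childValue (f : Formal 𝕜 L) (J : L.Cell) : 𝕜 :=
  if h : ∃ I : L.Cell, L.IsChild J.1 I.1 then f.diff h.choose (sInf J.1) else 0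

lemma childValue_eq (f : Formal 𝕜 L) {I J : L.Cell} (h : L.IsChild J.1 I.1) {x : ℝ}
    (hx : x ∈ J.1) : f.childValue J = f.diff I x := by
  have hex : ∃ I : L.Cell, L.IsChild J.1 I.1 := ⟨I, h⟩
  have hI : hex.choose = I :=
    Subtype.ext (IntervalLattice.parent_unique hex.choose_spec h)
  rw [childValue, dif_pos hex, hI]
  exact (f.1 I).2.1 J.1 h _ (IntervalLattice.cell_sInf_mem J) _ hx

lemma childValue_add (f g : Formal 𝕜 L) (J : L.Cell) :
    (f + g).childValue J = f.childValue J + g.childValue J := by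
  unfold childValue; split_ifs <;> simp

lemma childValue_smul (c : 𝕜) (f : Formal 𝕜 L) (J : L.Cell) :
    (c • f).childValue J = c • f.childValue J := by
  unfold childValue; split_ifs <;> simp

/-- The norm of the extended martingale Hardy space with exponents `1` and `q`, with values in
`[0, ∞]`: the `L¹` norm of `(∑_I |Δ_I f|^q + ∑_{I top, |I| < ∞} |E_I f|^q)^{1/q}`.
All the functions vanish off `X`. -/
def hardyENorm (q : ℝ) (f : Formal 𝕜 L) : ℝ≥0∞ :=
  ∫⁻ x, (∑' I : L.Cell, ‖f.diff I x‖ₑ ^ q + ∑' I : L.TopFin, ‖f.mean I x‖ₑ ^ q) ^ (1 / q)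

end Formal

/-- The BMO-like norm of a number sequence indexed by the lattice:
`sup_J ( |J|⁻¹ ∫_J ∑_{I ⊆ J} |s_I|^q 1_I )^{1/q}`. -/
def carlesonENorm (q : ℝ) (s : L.Cell → 𝕜) : ℝ≥0∞ :=
  ⨆ J : L.Cell, ((volume J.1)⁻¹ * ∫⁻ x in J.1,
    ∑' I : {I : L.Cell // I.1 ⊆ J.1}, I.1.1.indicator (fun _ => ‖s I.1‖ₑ ^ q) x) ^ (1 / q)

/-- The norm of the extended BMO space, with values in `[0, ∞]`: the maximum of the BMO norm of the
martingale differences and of `sup_I ‖E_I f‖_∞`. -/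
def Formal.bmoENorm (q : ℝ) (f : Formal 𝕜 L) : ℝ≥0∞ :=
  max (carlesonENorm q f.childValue) (⨆ (I : L.TopFin) (x : ℝ), ‖f.mean I x‖ₑ)

/-! ### The norm axioms -/

/-- The axioms of a norm that may take the value `∞`. -/
structure IsENorm {V : Type*} [AddCommGroup V] [Module 𝕜 V] (N : V → ℝ≥0∞) : Prop where
  add_le : ∀ f g, N (f + g) ≤ N f + N g
  smul_eq : ∀ (c : 𝕜) f, N (c • f) = ‖c‖ₑ * N f
  eq_zero : ∀ f, N f = 0 → f = 0

/-- The elements of finite norm. -/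
def IsENorm.finite {V : Type*} [AddCommGroup V] [Module 𝕜 V] {N : V → ℝ≥0∞}
    (h : IsENorm (𝕜 := 𝕜) N) : Submodule 𝕜 V where
  carrier := {f | N f < ∞}
  zero_mem' := by
    have := h.smul_eq 0 0
    simp only [zero_smul, enorm_zero, zero_mul] at this
    simp [this]
  add_mem' := fun {f g} hf hg => (h.add_le f g).trans_lt (ENNReal.add_lt_top.2 ⟨hf, hg⟩)
  smul_mem' := fun c f hf => by
    change N (c • f) < ∞
    rw [h.smul_eq]
    exact ENNReal.mul_lt_top enorm_lt_top hf

lemma IsENorm.core {V : Type*} [AddCommGroup V] [Module 𝕜 V] {N : V → ℝ≥0∞}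
    (h : IsENorm (𝕜 := 𝕜) N) :
    letI : Norm h.finite := ⟨fun f => (N f.1).toReal⟩
    NormedSpace.Core 𝕜 h.finite :=
  let : Norm h.finite := ⟨fun f => (N f.1).toReal⟩
  { norm_nonneg := fun f => ENNReal.toReal_nonneg
    norm_smul := fun c f => by
      change (N (c • f.1)).toReal = ‖c‖ * (N f.1).toReal
      rw [h.smul_eq, ENNReal.toReal_mul, toReal_enorm]
    norm_triangle := fun f g => by
      change (N (f.1 + g.1)).toReal ≤ (N f.1).toReal + (N g.1).toReal
      have hf : N f.1 < ∞ := f.2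
      have hg : N g.1 < ∞ := g.2
      rw [← ENNReal.toReal_add hf.ne hg.ne]
      exact ENNReal.toReal_mono (ENNReal.add_lt_top.2 ⟨hf, hg⟩).ne (h.add_le _ _)
    norm_eq_zero_iff := fun f => by
      change (N f.1).toReal = 0 ↔ f = 0
      have hf : N f.1 < ∞ := f.2
      rw [ENNReal.toReal_eq_zero_iff]
      constructor
      · rintro (h0 | h0)
        · exact Subtype.ext (h.eq_zero _ h0)
        · exact absurd h0 hf.ne
      · rintro rfl
        left
        have := h.smul_eq 0 0
        simpa using this }

lemma tsum_Lp_add_le {ι : Type*} {q : ℝ} (hq : 1 ≤ q) (a b : ι → ℝ≥0∞) :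
    (∑' i, (a i + b i) ^ q) ^ (1 / q) ≤ (∑' i, a i ^ q) ^ (1 / q) + (∑' i, b i ^ q) ^ (1 / q) := by
  letI : MeasurableSpace ι := ⊤
  have := ENNReal.lintegral_Lp_add_le (μ := Measure.count) (f := a) (g := b) (p := q)
    measurable_from_top.aemeasurable measurable_from_top.aemeasurable hq
  simpa [lintegral_count] using this

lemma tsum_smul_rpow {ι : Type*} {q : ℝ} (hq : 0 ≤ q) (c : ℝ≥0∞) (a : ι → ℝ≥0∞) :
    ∑' i, (c * a i) ^ q = c ^ q * ∑' i, a i ^ q := by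
  simp_rw [ENNReal.mul_rpow_of_nonneg _ _ hq, ENNReal.tsum_mul_left]

lemma tsum_add_tsum {ι κ : Type*} (a : ι → ℝ≥0∞) (b : κ → ℝ≥0∞) :
    ∑' i, a i + ∑' j, b j = ∑' z : ι ⊕ κ, Sum.elim a b z :=
  ((ENNReal.summable.hasSum (f := a)).sum (f := Sum.elim a b)
    (ENNReal.summable.hasSum (f := b))).tsum_eq.symm

lemma enorm_add_rpow_le {q : ℝ} (hq : 1 ≤ q) (a b : 𝕜) : ‖a + b‖ₑ ^ q ≤ (‖a‖ₑ + ‖b‖ₑ) ^ q :=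
  ENNReal.rpow_le_rpow (enorm_add_le a b) (by linarith)

lemma isENorm_hardy (L : IntervalLattice X) {q : ℝ} (hq : 1 ≤ q) :
    IsENorm (𝕜 := 𝕜) (Formal.hardyENorm (𝕜 := 𝕜) (L := L) q) := by
  have hq0 : 0 < q := by linarith
  -- rewrite the norm through one sum
  let A : Formal 𝕜 L → (L.Cell ⊕ L.TopFin) → ℝ → ℝ≥0∞ := fun f z x =>
    Sum.elim (fun I => ‖f.diff I x‖ₑ) (fun I => ‖f.mean I x‖ₑ) z
  have hA : ∀ f : Formal 𝕜 L, f.hardyENorm q = ∫⁻ x, (∑' z, A f z x ^ q) ^ (1 / q) := by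
    intro f
    unfold Formal.hardyENorm
    refine lintegral_congr fun x => ?_
    rw [tsum_add_tsum]
    congr 2
    funext z
    cases z <;> rfl
  have hAm : ∀ (f : Formal 𝕜 L) z, AEMeasurable (A f z) := by
    rintro f (I | I)
    · exact (f.measurable_diff I).enorm
    · exact (f.measurable_mean I).enorm.aemeasurable
  have hm : ∀ f : Formal 𝕜 L, AEMeasurable fun x => (∑' z, A f z x ^ q) ^ (1 / q) := fun f =>
    (AEMeasurable.tsum fun z => (hAm f z).pow_const q).pow_const _
  refine ⟨fun f g => ?_, fun c f => ?_, fun f hf => ?_⟩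
  · rw [hA, hA, hA, ← lintegral_add_left' (hm f)]
    refine lintegral_mono fun x => ?_
    refine le_trans ?_ (tsum_Lp_add_le hq (fun z => A f z x) fun z => A g z x)
    refine ENNReal.rpow_le_rpow (ENNReal.tsum_le_tsum fun z => ?_) (by positivity)
    cases z
    · exact enorm_add_rpow_le hq _ _
    · exact enorm_add_rpow_le hq _ _
  · rw [hA, hA, ← lintegral_const_mul'' _ (hm f)]
    refine lintegral_congr fun x => ?_
    have h1 : ∀ z, A (c • f) z x = ‖c‖ₑ * A f z x := by
      rintro (I | I) <;> simp [A]
    simp_rw [h1]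
    rw [tsum_smul_rpow hq0.le, ENNReal.mul_rpow_of_nonneg _ _ (by positivity), ← ENNReal.rpow_mul,
      mul_one_div_cancel hq0.ne', ENNReal.rpow_one]
  · rw [hA, lintegral_eq_zero_iff' (hm f)] at hf
    have h0 : ∀ z, ∀ᵐ x, A f z x = 0 := by
      intro z
      filter_upwards [hf] with x hx
      have h1 : ∑' z, A f z x ^ q = 0 := by
        simpa [ENNReal.rpow_eq_zero_iff, hq0, hq0.not_gt, -ENNReal.tsum_eq_zero] using hx
      have := ENNReal.tsum_eq_zero.1 h1 z
      simpa [ENNReal.rpow_eq_zero_iff, hq0, hq0.not_gt] using this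
    have hex : ∀ (z) (J : L.Cell), ∃ x ∈ J.1, A f z x = 0 := by
      intro z J
      by_contra! hcon
      have h1 : volume J.1 ≤ volume {x | ¬ A f z x = 0} := measure_mono fun x hx => hcon x hx
      have h2 : volume {x | ¬ A f z x = 0} = 0 := h0 z
      exact (IntervalLattice.cell_volume_pos J).ne' (le_antisymm (h1.trans h2.le) bot_le)
    refine Formal.ext (fun I => ?_) fun I => ?_
    · funext x
      by_cases hx : ∃ J, L.IsChild J I.1 ∧ x ∈ J
      · obtain ⟨J, hJ, hxJ⟩ := hx
        obtain ⟨y, hy, hy0⟩ := hex (Sum.inl I) ⟨J, hJ.cell⟩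
        have := (f.1 I).2.1 J hJ x hxJ y hy
        change f.diff I x = f.diff I y at this
        rw [this]
        simpa [A] using hy0
      · push Not at hx
        exact (f.1 I).2.2.1 x hx
    · obtain ⟨c, hc⟩ := (f.2 I).2
      obtain ⟨J, hJ⟩ := I.2.1.exists_cell
      obtain ⟨y, hy, hy0⟩ := hex (Sum.inr I) J
      have hfm : f.mean I = I.1.indicator fun _ => c := hc
      have hc0 : c = 0 := by
        have hy1 : f.mean I y = 0 := by simpa [A] using hy0
        rw [hfm] at hy1
        simpa [hJ hy] using hy1
      rw [hfm, hc0]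
      funext x
      simp

lemma carleson_add_le (L : IntervalLattice X) {q : ℝ} (hq : 1 ≤ q) (s t : L.Cell → 𝕜) :
    carlesonENorm q (s + t) ≤ carlesonENorm q s + carlesonENorm q t := by
  have hq0 : 0 < q := by linarith
  refine iSup_le fun J => ?_
  let B : (L.Cell → 𝕜) → {I : L.Cell // I.1 ⊆ J.1} → ℝ → ℝ≥0∞ := fun s I x =>
    I.1.1.indicator (fun _ => ‖s I.1‖ₑ) x
  have hB : ∀ s I x, I.1.1.indicator (fun _ => ‖s I.1‖ₑ ^ q) x = B s I x ^ q := by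
    intro s I x
    by_cases hx : x ∈ I.1.1 <;> simp [B, hx, hq0]
  let F : (L.Cell → 𝕜) → ℝ → ℝ≥0∞ := fun s x => (∑' I, B s I x ^ q) ^ (1 / q)
  have hF : ∀ s x, ∑' I : {I : L.Cell // I.1 ⊆ J.1}, I.1.1.indicator (fun _ => ‖s I.1‖ₑ ^ q) x
      = F s x ^ q := by
    intro s x
    simp only [F]
    rw [← ENNReal.rpow_mul, one_div_mul_cancel hq0.ne', ENNReal.rpow_one]
    exact tsum_congr fun I => hB s I x
  have hBm : ∀ s I, Measurable (B s I) := fun s I =>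
    measurable_const.indicator (IntervalLattice.cell_measurable I.1)
  have hFm : ∀ s, Measurable (F s) := fun s =>
    (Measurable.tsum fun I => (hBm s I).pow_const q).pow_const _
  have hterm : ∀ s, ((volume J.1)⁻¹ * ∫⁻ x in J.1, F s x ^ q) ^ (1 / q)
      ≤ carlesonENorm q s := by
    intro s
    simp_rw [← hF]
    exact le_iSup (fun J : L.Cell => ((volume J.1)⁻¹ * ∫⁻ x in J.1,
      ∑' I : {I : L.Cell // I.1 ⊆ J.1}, I.1.1.indicator (fun _ => ‖s I.1‖ₑ ^ q) x) ^ (1 / q)) J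
  refine le_trans ?_ (add_le_add (hterm s) (hterm t))
  simp_rw [hF]
  have hpos : 0 ≤ 1 / q := by positivity
  rw [ENNReal.mul_rpow_of_nonneg _ _ hpos, ENNReal.mul_rpow_of_nonneg _ _ hpos,
    ENNReal.mul_rpow_of_nonneg _ _ hpos, ← mul_add]
  gcongr
  refine le_trans (ENNReal.rpow_le_rpow (lintegral_mono fun x => ENNReal.rpow_le_rpow ?_ hq0.le)
    hpos) (ENNReal.lintegral_Lp_add_le (hFm s).aemeasurable (hFm t).aemeasurable hq)
  refine le_trans (ENNReal.rpow_le_rpow (ENNReal.tsum_le_tsum fun I => ?_) hpos)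
    (tsum_Lp_add_le hq (fun I => B s I x) fun I => B t I x)
  refine ENNReal.rpow_le_rpow ?_ hq0.le
  by_cases hx : x ∈ I.1.1
  · simpa [B, hx] using enorm_add_le _ _
  · simp [B, hx]

lemma carleson_smul (L : IntervalLattice X) {q : ℝ} (hq : 1 ≤ q) (c : 𝕜) (s : L.Cell → 𝕜) :
    carlesonENorm q (c • s) = ‖c‖ₑ * carlesonENorm q s := by
  have hq0 : 0 < q := by linarith
  unfold carlesonENorm
  rw [ENNReal.mul_iSup]
  refine iSup_congr fun J => ?_
  have h1 : ∀ (I : {I : L.Cell // I.1 ⊆ J.1}) (x : ℝ),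
      I.1.1.indicator (fun _ => ‖(c • s) I.1‖ₑ ^ q) x
        = ‖c‖ₑ ^ q * I.1.1.indicator (fun _ => ‖s I.1‖ₑ ^ q) x := by
    intro I x
    by_cases hx : x ∈ I.1.1
    · simp [hx, ENNReal.mul_rpow_of_nonneg _ _ hq0.le]
    · simp [hx]
  simp_rw [h1, ENNReal.tsum_mul_left]
  rw [lintegral_const_mul' _ _ (ENNReal.rpow_ne_top_of_nonneg hq0.le enorm_ne_top), mul_left_comm,
    ENNReal.mul_rpow_of_nonneg _ _ (by positivity), ← ENNReal.rpow_mul,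
    mul_one_div_cancel hq0.ne', ENNReal.rpow_one]

lemma carleson_eq_zero (L : IntervalLattice X) {q : ℝ} (hq : 1 ≤ q) (s : L.Cell → 𝕜)
    (h : carlesonENorm q s = 0) (J : L.Cell) : s J = 0 := by
  have hq0 : 0 < q := by linarith
  have h1 := (ENNReal.iSup_eq_zero.1 h) J
  have h2 : ∫⁻ x in J.1, ∑' I : {I : L.Cell // I.1 ⊆ J.1},
      I.1.1.indicator (fun _ => ‖s I.1‖ₑ ^ q) x = 0 := by
    have hv := IntervalLattice.cell_volume_ne_top J
    simpa [ENNReal.rpow_eq_zero_iff, hq0, hq0.not_gt, hv] using h1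
  have h3 : ∫⁻ x in J.1, J.1.indicator (fun _ => ‖s J‖ₑ ^ q) x = 0 := by
    refine le_antisymm (le_trans (lintegral_mono fun x => ?_) h2.le) bot_le
    exact ENNReal.le_tsum (f := fun I : {I : L.Cell // I.1 ⊆ J.1} =>
      I.1.1.indicator (fun _ => ‖s I.1‖ₑ ^ q) x) ⟨J, subset_rfl⟩
  rw [setLIntegral_indicator (IntervalLattice.cell_measurable J), inter_self,
    setLIntegral_const, mul_eq_zero] at h3
  rcases h3 with h3 | h3
  · simpa [ENNReal.rpow_eq_zero_iff, hq0, hq0.not_gt] using h3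
  · exact absurd h3 (IntervalLattice.cell_volume_pos J).ne'

lemma isENorm_bmo (L : IntervalLattice X) {q : ℝ} (hq : 1 ≤ q) :
    IsENorm (𝕜 := 𝕜) (Formal.bmoENorm (𝕜 := 𝕜) (L := L) q) := by
  refine ⟨fun f g => ?_, fun c f => ?_, fun f hf => ?_⟩
  · refine max_le ?_ (iSup₂_le fun I x => ?_)
    · have : (f + g).childValue = f.childValue + g.childValue :=
        funext fun J => f.childValue_add g J
      rw [this]
      exact (carleson_add_le L hq _ _).trans (add_le_add (le_max_left _ _) (le_max_left _ _))
    · refine (enorm_add_le _ _).trans (add_le_add ?_ ?_)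
      · exact (le_iSup₂ (f := fun (I : L.TopFin) (x : ℝ) => ‖f.mean I x‖ₑ) I x).trans
          (le_max_right _ _)
      · exact (le_iSup₂ (f := fun (I : L.TopFin) (x : ℝ) => ‖g.mean I x‖ₑ) I x).trans
          (le_max_right _ _)
  · have : (c • f).childValue = c • f.childValue := funext fun J => f.childValue_smul c J
    unfold Formal.bmoENorm
    rw [this, carleson_smul L hq, mul_max]
    simp [ENNReal.mul_iSup]
  · have h1 : carlesonENorm q f.childValue = 0 :=
      le_antisymm ((le_max_left _ _).trans hf.le) bot_le
    have h2 : (⨆ (I : L.TopFin) (x : ℝ), ‖f.mean I x‖ₑ) = 0 :=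
      le_antisymm ((le_max_right _ _).trans hf.le) bot_le
    refine Formal.ext (fun I => ?_) fun I => ?_
    · funext x
      by_cases hx : ∃ J, L.IsChild J I.1 ∧ x ∈ J
      · obtain ⟨J, hJ, hxJ⟩ := hx
        have := f.childValue_eq (J := ⟨J, hJ.cell⟩) hJ hxJ
        rw [← this]
        exact carleson_eq_zero L hq _ h1 _
      · push Not at hx
        exact (f.1 I).2.2.1 x hx
    · funext x
      have h3 : ‖f.mean I x‖ₑ ≤ 0 := by
        rw [← h2]
        exact le_iSup₂ (f := fun (I : L.TopFin) (x : ℝ) => ‖f.mean I x‖ₑ) I x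
      simpa using h3

/-! ### The Hardy and BMO spaces -/

variable (𝕜 L) (q : ℝ) [hq : Fact (1 ≤ q)]

/-- The extended martingale Hardy space with exponents `1` and `q`. -/
def ExtHardy : Submodule 𝕜 (Formal 𝕜 L) := (isENorm_hardy (𝕜 := 𝕜) L hq.out).finite

/-- The extended martingale BMO space with exponent `q`. -/
def ExtBMO : Submodule 𝕜 (Formal 𝕜 L) := (isENorm_bmo (𝕜 := 𝕜) L hq.out).finite

instance : Norm (ExtHardy 𝕜 L q) := ⟨fun f => (f.1.hardyENorm q).toReal⟩

lemma extHardy_core : NormedSpace.Core 𝕜 (ExtHardy 𝕜 L q) :=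
  (isENorm_hardy (𝕜 := 𝕜) L hq.out).core

instance : NormedAddCommGroup (ExtHardy 𝕜 L q) :=
  NormedAddCommGroup.ofCore (extHardy_core 𝕜 L q)

instance : NormedSpace 𝕜 (ExtHardy 𝕜 L q) :=
  NormedSpace.ofCore (extHardy_core 𝕜 L q)

instance : Norm (ExtBMO 𝕜 L q) := ⟨fun f => (f.1.bmoENorm q).toReal⟩

lemma extBMO_core : NormedSpace.Core 𝕜 (ExtBMO 𝕜 L q) :=
  (isENorm_bmo (𝕜 := 𝕜) L hq.out).core

instance : NormedAddCommGroup (ExtBMO 𝕜 L q) :=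
  NormedAddCommGroup.ofCore (extBMO_core 𝕜 L q)

instance : NormedSpace 𝕜 (ExtBMO 𝕜 L q) :=
  NormedSpace.ofCore (extBMO_core 𝕜 L q)

/-- The formal decompositions without mean terms: `E_I f = 0` for all `I`. -/
def noMean : Submodule 𝕜 (Formal 𝕜 L) where
  carrier := {f | ∀ I, f.mean I = 0}
  zero_mem' := fun I => rfl
  add_mem' := fun {f g} hf hg I => by simp [hf I, hg I]
  smul_mem' := fun c f hf I => by simp [hf I]

/-- The martingale Hardy space with exponents `1` and `q`: the subspace of the extended space given
by `E_I f = 0` for all tail atoms `I` of finite length, with the same norm. -/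
abbrev Hardy : Submodule 𝕜 (ExtHardy 𝕜 L q) := (noMean 𝕜 L).comap (ExtHardy 𝕜 L q).subtype

/-- The martingale BMO space with exponent `q`, of decompositions without mean terms. -/
abbrev BMO : Submodule 𝕜 (ExtBMO 𝕜 L q) := (noMean 𝕜 L).comap (ExtBMO 𝕜 L q).subtype

variable {𝕜 L}

/-- `HasPairing f g s`: the series `⟨f, g⟩ = ∑_I ∫ Δ_I f Δ_I g + ∑_{I top, |I| < ∞} ∫ E_I f E_I g`
converges unconditionally, with sum `s` (for `g` or `f` without mean terms the second series
vanishes). -/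
def HasPairing (f g : Formal 𝕜 L) (s : 𝕜) : Prop :=
  ∃ a b : 𝕜, HasSum (fun I : L.Cell => ∫ x, f.diff I x * g.diff I x) a ∧
    HasSum (fun I : L.TopFin => ∫ x, f.mean I x * g.mean I x) b ∧ s = a + b

end MartingaleBMO

end

noncomputable section

namespace MartingaleBMO

/-! ### Nesting of intervals and children -/

namespace IntervalLattice

variable {X : Set ℝ} {L : IntervalLattice X}

/-! Write p for q'. The upper bound is a Carleson embedding. Every interval J is a child of at most
one interval, so the difference part of the pairing is dominated by ∑_J |x_J(f)| |x_J(g)| |J|, a sum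
over values on children (`Formal.tsum_apply_diff`). By Chebyshev, on at least half of J the local
sum ∑_{I ⊆ J} |x_I(g)|^p 1_I is at most twice the p-th power of the BMO norm (`volume_le_goodPart`).
Replacing |J| by twice the length of this good part and applying Hölder's inequality for sums at
each point x, one needs only that ∑ |x_J(g)|^p over the J with x in the good part of J is bounded.
It is, because the intervals containing x are nested, so the largest one in a finite selection
controls all the others (`tsum_goodPart_le`). The mean terms live on disjoint sets and need only the
L¹–L^∞ bound.

Conversely, a functional Φ on the extended Hardy space acts on each finite-dimensional component
space as integration against a unique element of that space. These elements form a decomposition g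
(`exists_represents`), and g determines Φ because finite truncations are dense
(`ExtHardy.tendsto_trunc`, `Represents.unique`). The BMO norm of g is bounded by testing Φ
(`Represents.bmoENorm_le`). For intervals K inside a fixed J the test differences are the dual
powers conj(Δ_K g) |Δ_K g|^(p-2), made mean-free on K; on J the L¹ norm of the test function is
bounded through its L^q norm by Hölder, and a power of the sum is absorbed
(`Represents.sum_lintegral_le`). The value x_J(g) itself comes from the parent of J and is tested
separately with a centered indicator of J (`Represents.enorm_childValue_le`).

The spaces without mean terms follow from the extended ones, since dropping the mean terms is a
projection of norm at most 1 (`dropMean`). -/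

lemma subset_or_subset (I J : L.Cell) {x : ℝ} (hI : x ∈ I.1) (hJ : x ∈ J.1) :
    I.1 ⊆ J.1 ∨ J.1 ⊆ I.1 := by
  obtain ⟨k, hk⟩ := I.2
  obtain ⟨l, hl⟩ := J.2
  rcases le_total k l with h | h
  · exact .inr (subset_of_le h hk hl hI hJ)
  · exact .inl (subset_of_le h hl hk hJ hI)

lemma IsChild.subset {I J : Set ℝ} (h : L.IsChild J I) : J ⊆ I := by
  obtain ⟨k, -, -, h⟩ := h
  exact h

lemma IsChild.eq_of_mem {I J K : Set ℝ} (hJ : L.IsChild J I) (hK : L.IsChild K I) {x : ℝ}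
    (hxJ : x ∈ J) (hxK : x ∈ K) : J = K := by
  obtain ⟨k, h1, h2, -⟩ := hJ
  obtain ⟨l, h1', h2', -⟩ := hK
  obtain rfl : k = l := h1.unique h1'
  exact IntervalLattice.eq_of_mem h2 h2' hxJ hxK

lemma IsChild.exists_of_mem {I J : Set ℝ} (h : L.IsChild J I) {x : ℝ} (hx : x ∈ I) :
    ∃ K, L.IsChild K I ∧ x ∈ K := by
  obtain ⟨k, h1, -, -⟩ := h
  obtain ⟨K, hK, hKI, hxK⟩ := exists_succ_mem h1.1 hx
  exact ⟨K, ⟨k, h1, hK, hKI⟩, hxK⟩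

lemma finite_children (I : Set ℝ) : {J | L.IsChild J I}.Finite := by
  by_cases h : ∃ k, L.HasRank I k
  · obtain ⟨k, hk⟩ := h
    obtain ⟨F, hF, hFs, hFI⟩ := L.refine k I hk.1
    refine hF.subset ?_
    rintro J hJ
    have hx := cell_sInf_mem ⟨J, hJ.cell⟩
    have hxI := hJ.subset hx
    obtain ⟨K, hK, hxK⟩ := hFI.ge hxI
    have hKI : L.IsChild K I := ⟨k, hk, hFs hK, hFI ▸ subset_sUnion_of_mem hK⟩
    rwa [show J = K from IsChild.eq_of_mem hJ hKI hx hxK]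
  · convert Set.finite_empty
    ext J
    simp only [mem_ofPred_eq, mem_empty_iff_false, iff_false]
    rintro ⟨k, hk, -⟩
    exact h ⟨k, hk⟩

/-- If a child of `K` is properly contained in `J`, then `K` is contained in `J`. -/
lemma IsChild.parent_subset {I J K : L.Cell} (h : L.IsChild I.1 K.1) (hIJ : I.1 ⊆ J.1)
    (hne : I ≠ J) : K.1 ⊆ J.1 := by
  obtain ⟨k, hk, hI, hIK⟩ := h
  obtain ⟨m, hm⟩ := J.2
  have hx := cell_sInf_mem I
  -- If J belonged to a generation after the rank k of K, it would lie inside the child I, which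
  -- forces I = J.
  rcases lt_or_ge k m with hkm | hkm
  · exact absurd (Subtype.ext (subset_antisymm hIJ
      (subset_of_le (by omega) hI hm hx (hIJ hx)))) hne
  · exact subset_of_le hkm hm hk.1 (hIJ hx) (hIK hx)

end IntervalLattice

variable {𝕜 : Type*} [RCLike 𝕜] {X : Set ℝ} {L : IntervalLattice X}

/-! ### Differences in terms of child values -/

open Classical in
-- The children of I are disjoint, so at most one term survives at x. A general φ covers both the
-- products |a| |b| of the pairing and the powers |a|^q of the square functions.
lemma Formal.apply_diff_eq_tsum (φ : 𝕜 → 𝕜 → ℝ≥0∞) (hφ : φ 0 0 = 0) (f g : Formal 𝕜 L)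
    (I : L.Cell) (x : ℝ) : φ (f.diff I x) (g.diff I x) = ∑' J : L.Cell,
      if L.IsChild J.1 I.1 then J.1.indicator (fun _ => φ (f.childValue J) (g.childValue J)) x
      else 0 := by
  by_cases h : ∃ J, L.IsChild J I.1 ∧ x ∈ J
  · obtain ⟨J, hJ, hx⟩ := h
    rw [tsum_eq_single ⟨J, hJ.cell⟩]
    · rw [if_pos hJ, indicator_of_mem hx, f.childValue_eq (J := ⟨J, hJ.cell⟩) hJ hx,
        g.childValue_eq (J := ⟨J, hJ.cell⟩) hJ hx]
    · intro K hK
      split_ifs with hKI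
      · exact indicator_of_notMem (fun hxK => hK (Subtype.ext (hKI.eq_of_mem hJ hxK hx))) _
      · rfl
  · push Not at h
    have hf : f.diff I x = 0 := (f.1 I).2.2.1 x h
    have hg : g.diff I x = 0 := (g.1 I).2.2.1 x h
    rw [hf, hg, hφ, eq_comm, ENNReal.tsum_eq_zero]
    intro J
    split_ifs with hJ
    · exact indicator_of_notMem (h _ hJ) _
    · rfl

lemma Formal.childValue_eq_zero (f : Formal 𝕜 L) {J : L.Cell}
    (h : ∀ I : L.Cell, ¬ L.IsChild J.1 I.1) : f.childValue J = 0 := by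
  unfold childValue
  rw [dif_neg (by simpa using h)]

open Classical in
-- Uniqueness of the parent leaves one term. If J has no parent the sum is empty, hence the
-- condition on `a`; child values meet it by the convention that they vanish there.
lemma tsum_ite_isChild (a : L.Cell → ℝ≥0∞) (J : L.Cell)
    (h : (∀ I : L.Cell, ¬ L.IsChild J.1 I.1) → a J = 0) :
    ∑' I : L.Cell, (if L.IsChild J.1 I.1 then a J else 0) = a J := by
  by_cases hJ : ∃ I : L.Cell, L.IsChild J.1 I.1
  · obtain ⟨I, hI⟩ := hJ
    rw [tsum_eq_single I, if_pos hI]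
    intro K hK
    rw [if_neg fun hJK => hK (Subtype.ext (IntervalLattice.parent_unique hJK hI))]
  · push Not at hJ
    simp [hJ, h hJ]

lemma Formal.tsum_apply_diff (φ : 𝕜 → 𝕜 → ℝ≥0∞) (hφ : φ 0 0 = 0) (f g : Formal 𝕜 L)
    (x : ℝ) : ∑' I : L.Cell, φ (f.diff I x) (g.diff I x) =
      ∑' J : L.Cell, J.1.indicator (fun _ => φ (f.childValue J) (g.childValue J)) x := by
  classical
  simp_rw [f.apply_diff_eq_tsum φ hφ g]
  rw [ENNReal.tsum_comm]
  refine tsum_congr fun J => tsum_ite_isChild (fun J : L.Cell =>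
    J.1.indicator (fun _ => φ (f.childValue J) (g.childValue J)) x) J fun h => ?_
  simp [f.childValue_eq_zero h, g.childValue_eq_zero h, hφ]

/-! ### The Carleson embedding -/

lemma tsum_mul_le_Lp_mul_Lq {ι : Type*} {p q : ℝ} (hpq : p.HolderConjugate q) (a b : ι → ℝ≥0∞) :
    ∑' i, a i * b i ≤ (∑' i, a i ^ p) ^ (1 / p) * (∑' i, b i ^ q) ^ (1 / q) := by
  let : MeasurableSpace ι := ⊤
  have := ENNReal.lintegral_mul_le_Lp_mul_Lq (μ := Measure.count) hpq (f := a) (g := b)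
    measurable_from_top.aemeasurable measurable_from_top.aemeasurable
  simpa [lintegral_count] using this

/-- The local square function of a sequence. -/
def localSum (p : ℝ) (y : L.Cell → 𝕜) (J : L.Cell) (x : ℝ) : ℝ≥0∞ :=
  ∑' I : {I : L.Cell // I.1 ⊆ J.1}, I.1.1.indicator (fun _ => ‖y I.1‖ₑ ^ p) x

lemma localSum_eq_tsum (p : ℝ) (y : L.Cell → 𝕜) (J : L.Cell) (x : ℝ) : localSum p y J x =
    ∑' I : L.Cell, {I : L.Cell | I.1 ⊆ J.1}.indicator
      (fun I => I.1.indicator (fun _ => ‖y I‖ₑ ^ p) x) I :=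
  tsum_subtype {I : L.Cell | I.1 ⊆ J.1} fun I : L.Cell => I.1.indicator (fun _ => ‖y I‖ₑ ^ p) x

lemma measurable_localSum (p : ℝ) (y : L.Cell → 𝕜) (J : L.Cell) :
    Measurable (localSum p y J) :=
  Measurable.tsum fun I => measurable_const.indicator (IntervalLattice.cell_measurable I.1)

lemma setLIntegral_localSum_le {p : ℝ} (hp : 0 < p) (y : L.Cell → 𝕜) (J : L.Cell) :
    ∫⁻ x in J.1, localSum p y J x ≤ carlesonENorm p y ^ p * volume J.1 := by
  have h : ((volume J.1)⁻¹ * ∫⁻ x in J.1, localSum p y J x) ^ (1 / p) ≤ carlesonENorm p y :=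
    le_iSup (fun J : L.Cell => ((volume J.1)⁻¹ * ∫⁻ x in J.1, localSum p y J x) ^ (1 / p)) J
  rw [one_div, ENNReal.rpow_inv_le_iff hp, mul_comm, ← div_eq_mul_inv,
    ENNReal.div_le_iff (IntervalLattice.cell_volume_pos J).ne'
      (IntervalLattice.cell_volume_ne_top J)] at h
  exact h

/-- The part of `J` on which the local square function is controlled by the Carleson norm. -/
def goodPart (p : ℝ) (y : L.Cell → 𝕜) (J : L.Cell) : Set ℝ :=
  J.1 ∩ {x | localSum p y J x ≤ 2 * carlesonENorm p y ^ p}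

lemma measurableSet_goodPart (p : ℝ) (y : L.Cell → 𝕜) (J : L.Cell) :
    MeasurableSet (goodPart p y J) :=
  (IntervalLattice.cell_measurable J).inter
    (measurableSet_le (measurable_localSum p y J) measurable_const)

/-- Chebyshev: the mean of the local sum over J is at most N, so it can exceed 2N on at most half of
J. The norm has to be nonzero and finite because N is cancelled. -/
lemma volume_le_goodPart {p : ℝ} (hp : 0 < p) {y : L.Cell → 𝕜} (h0 : carlesonENorm p y ≠ 0)
    (ht : carlesonENorm p y ≠ ∞) (J : L.Cell) : volume J.1 ≤ 2 * volume (goodPart p y J) := by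
  set N := carlesonENorm p y ^ p with hN
  have hN0 : N ≠ 0 := by simp [hN, ENNReal.rpow_eq_zero_iff, h0, ht]
  have hNt : N ≠ ∞ := ENNReal.rpow_ne_top_of_nonneg hp.le ht
  have hv := IntervalLattice.cell_volume_ne_top J
  have hJ := IntervalLattice.cell_measurable J
  have h1 : 2 * volume (J.1 \ goodPart p y J) ≤ volume J.1 := by
    have h2 : (2 * N) * volume (J.1 \ goodPart p y J) ≤ N * volume J.1 := by
      refine le_trans ?_ ((mul_meas_ge_le_lintegral (μ := volume.restrict J.1)
        (measurable_localSum p y J) (2 * N)).trans (setLIntegral_localSum_le hp y J))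
      refine mul_le_mul_right ?_ _
      rw [Measure.restrict_apply' hJ]
      refine measure_mono fun x hx => ⟨?_, hx.1⟩
      have : ¬ localSum p y J x ≤ 2 * N := fun h => hx.2 ⟨hx.1, h⟩
      exact (not_le.1 this).le
    rw [mul_comm 2 N, mul_assoc] at h2
    exact (ENNReal.mul_le_mul_iff_right hN0 hNt).1 h2
  have h3 : volume J.1 ≤ volume (goodPart p y J) + volume (J.1 \ goodPart p y J) := by
    refine (measure_mono ?_).trans (measure_union_le _ _)
    simp
  have h4 : volume J.1 + volume J.1 ≤ 2 * volume (goodPart p y J) + volume J.1 := by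
    calc volume J.1 + volume J.1
        ≤ 2 * volume (goodPart p y J) + 2 * volume (J.1 \ goodPart p y J) := by
          rw [← two_mul, ← mul_add]; gcongr
      _ ≤ _ := by gcongr
  exact (ENNReal.add_le_add_iff_right hv).1 h4

/-- Intervals whose good part contains x are nested. In a finite selection all of them lie in the
largest, J₀, so the partial sum is part of the local sum of J₀ at x, which is small since x is in
the good part of J₀. -/
lemma tsum_goodPart_le (p : ℝ) (y : L.Cell → 𝕜) (x : ℝ) :
    ∑' J : L.Cell, (goodPart p y J).indicator (fun _ => ‖y J‖ₑ ^ p) x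
      ≤ 2 * carlesonENorm p y ^ p := by
  classical
  refine ENNReal.summable.tsum_le_of_sum_le fun S => ?_
  have h1 : ∑ J ∈ S, (goodPart p y J).indicator (fun _ => ‖y J‖ₑ ^ p) x =
      ∑ J ∈ S.filter fun J => x ∈ goodPart p y J, ‖y J‖ₑ ^ p := by
    rw [Finset.sum_filter]
    exact Finset.sum_congr rfl fun J _ => by simp [indicator_apply]
  rw [h1]
  rcases (S.filter fun J => x ∈ goodPart p y J).eq_empty_or_nonempty with he | hne
  · simp [he]
  obtain ⟨J₀, hJ₀⟩ := Finset.exists_maximal hne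
  have hx₀ := (Finset.mem_filter.1 hJ₀.1).2
  refine le_trans ?_ hx₀.2
  have h2 : ∀ J ∈ S.filter fun J => x ∈ goodPart p y J, J.1 ⊆ J₀.1 ∧ x ∈ J.1 := by
    intro J hJ
    have hx := (Finset.mem_filter.1 hJ).2
    refine ⟨?_, hx.1⟩
    rcases IntervalLattice.subset_or_subset J J₀ hx.1 hx₀.1 with h | h
    · exact h
    · exact hJ₀.2 hJ h
  rw [localSum_eq_tsum]
  refine le_trans (Finset.sum_le_sum fun J hJ => ?_)
    (ENNReal.sum_le_tsum (S.filter fun J => x ∈ goodPart p y J))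
  rw [indicator_of_mem (show J ∈ {I : L.Cell | I.1 ⊆ J₀.1} from (h2 J hJ).1),
    indicator_of_mem (h2 J hJ).2]

/-- Duality between the sequence spaces: the sum of products is controlled by the product of the
Hardy type norm and the Carleson norm. -/
lemma tsum_mul_volume_le {p q : ℝ} (hpq : q.HolderConjugate p) (z y : L.Cell → 𝕜)
    (ht : carlesonENorm p y ≠ ∞) :
    ∑' J : L.Cell, ‖z J‖ₑ * ‖y J‖ₑ * volume J.1 ≤ 4 *
      (∫⁻ x, (∑' J : L.Cell, J.1.indicator (fun _ => ‖z J‖ₑ ^ q) x) ^ (1 / q)) *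
        carlesonENorm p y := by
  have hp := hpq.symm.pos
  have hq := hpq.pos
  by_cases h0 : carlesonENorm p y = 0
  · have : ∀ J, y J = 0 := carleson_eq_zero L hpq.symm.lt.le y h0
    simp [this]
  calc ∑' J : L.Cell, ‖z J‖ₑ * ‖y J‖ₑ * volume J.1
      ≤ ∑' J : L.Cell, 2 * ∫⁻ x, (goodPart p y J).indicator (fun _ => ‖z J‖ₑ * ‖y J‖ₑ) x := by
        -- The factor 2 pays for shrinking J to its good part.
        refine ENNReal.tsum_le_tsum fun J => ?_
        rw [lintegral_indicator_const (measurableSet_goodPart p y J), mul_left_comm]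
        gcongr
        exact volume_le_goodPart hp h0 ht J
    _ = 2 * ∫⁻ x, ∑' J : L.Cell, (goodPart p y J).indicator (fun _ => ‖z J‖ₑ * ‖y J‖ₑ) x := by
        rw [ENNReal.tsum_mul_left, lintegral_tsum fun J =>
          (measurable_const.indicator (measurableSet_goodPart p y J)).aemeasurable]
    _ ≤ 2 * ∫⁻ x, (∑' J : L.Cell, J.1.indicator (fun _ => ‖z J‖ₑ ^ q) x) ^ (1 / q) *
          (2 * carlesonENorm p y) := by
        gcongr with x
        have h1 : ∀ J : L.Cell, (goodPart p y J).indicator (fun _ => ‖z J‖ₑ * ‖y J‖ₑ) x ≤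
            J.1.indicator (fun _ => ‖z J‖ₑ) x * (goodPart p y J).indicator (fun _ => ‖y J‖ₑ) x := by
          intro J
          by_cases hx : x ∈ goodPart p y J
          · simp [hx, hx.1]
          · simp [hx]
        refine (ENNReal.tsum_le_tsum h1).trans ((tsum_mul_le_Lp_mul_Lq hpq _ _).trans ?_)
        have h2 : ∀ (s : Set ℝ) (c : ℝ≥0∞) {r : ℝ}, 0 < r →
            (s.indicator (fun _ => c) x) ^ r = s.indicator (fun _ => c ^ r) x := by
          intro s c r hr
          by_cases hx : x ∈ s <;> simp [hx, hr]
        simp_rw [h2 _ _ hp, h2 _ _ hq]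
        gcongr
        rw [one_div, ENNReal.rpow_inv_le_iff hp, ENNReal.mul_rpow_of_nonneg _ _ hp.le]
        refine (tsum_goodPart_le p y x).trans ?_
        -- What remains is 2 ≤ 2^p: the bound 2N^p on the sum of p-th powers becomes 2N after the
        -- root, and the total constant is 2 · 2 = 4.
        gcongr
        conv_lhs => rw [← ENNReal.rpow_one 2]
        exact ENNReal.rpow_le_rpow_of_exponent_le (by norm_num) hpq.symm.lt.le
    _ = _ := by
        rw [lintegral_mul_const' _ _ (ENNReal.mul_ne_top (by norm_num) ht)]
        ring

end MartingaleBMO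

end

noncomputable section

namespace MartingaleBMO

variable {𝕜 : Type*} [RCLike 𝕜] {X : Set ℝ} {L : IntervalLattice X}

/-! ### Components -/

namespace Formal

/-- The martingale differences and the mean terms as one family. -/
def comp (f : Formal 𝕜 L) (z : L.Cell ⊕ L.TopFin) : ℝ → 𝕜 := Sum.elim f.diff f.mean z

@[simp] lemma comp_inl (f : Formal 𝕜 L) (I : L.Cell) : f.comp (.inl I) = f.diff I := rfl
@[simp] lemma comp_inr (f : Formal 𝕜 L) (I : L.TopFin) : f.comp (.inr I) = f.mean I := rfl

lemma comp_add (f g : Formal 𝕜 L) (z) : (f + g).comp z = f.comp z + g.comp z := by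
  cases z <;> rfl

lemma comp_smul (c : 𝕜) (f : Formal 𝕜 L) (z) : (c • f).comp z = c • f.comp z := by
  cases z <;> rfl

lemma ext_comp {f g : Formal 𝕜 L} (h : ∀ z, f.comp z = g.comp z) : f = g :=
  Formal.ext (fun I => h (.inl I)) fun I => h (.inr I)

lemma hardyENorm_eq (q : ℝ) (f : Formal 𝕜 L) :
    f.hardyENorm q = ∫⁻ x, (∑' z, ‖f.comp z x‖ₑ ^ q) ^ (1 / q) := by
  unfold hardyENorm
  refine lintegral_congr fun x => ?_
  rw [tsum_add_tsum]
  congr 2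
  funext z
  cases z <;> rfl

lemma exists_mean_eq (f : Formal 𝕜 L) (I : L.TopFin) :
    ∃ c : 𝕜, f.mean I = I.1.indicator fun _ => c := (f.2 I).2

lemma diff_apply_eq_zero (f : Formal 𝕜 L) (I : L.Cell) {x : ℝ} (hx : x ∉ I.1) :
    f.diff I x = 0 :=
  (f.1 I).2.2.1 x fun _ hJ hxJ => hx (hJ.subset hxJ)

lemma integrable_comp (f : Formal 𝕜 L) (z) : Integrable (f.comp z) := by
  rcases z with I | I
  · exact (f.1 I).2.2.2.1
  · obtain ⟨c, hc⟩ := f.exists_mean_eq I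
    rw [comp_inr, hc, integrable_indicator_iff I.2.1.measurable]
    exact integrableOn_const I.2.2.ne

lemma exists_bound_comp (f : Formal 𝕜 L) (z) : ∃ C, ∀ x, ‖f.comp z x‖ ≤ C := by
  rcases z with I | I
  · obtain ⟨C, hC⟩ := ((IntervalLattice.finite_children (L := L) I.1).image
      fun J => ‖f.diff I (sInf J)‖).bddAbove
    refine ⟨max C 0, fun x => ?_⟩
    by_cases h : ∃ J, L.IsChild J I.1 ∧ x ∈ J
    · obtain ⟨J, hJ, hx⟩ := h
      refine le_max_of_le_left (hC ⟨J, hJ, ?_⟩)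
      exact congrArg norm ((f.1 I).2.1 J hJ _ (IntervalLattice.cell_sInf_mem ⟨J, hJ.cell⟩) x hx)
    · push Not at h
      have h0 : f.diff I x = 0 := (f.1 I).2.2.1 x h
      simp [h0]
  · obtain ⟨c, hc⟩ := f.exists_mean_eq I
    refine ⟨‖c‖, fun x => ?_⟩
    rw [comp_inr, hc]
    exact norm_indicator_le_norm_self _ _

lemma integrable_comp_mul (f g : Formal 𝕜 L) (z) :
    Integrable fun x => f.comp z x * g.comp z x := by
  obtain ⟨C, hC⟩ := f.exists_bound_comp z
  exact (g.integrable_comp z).bdd_mul (f.integrable_comp z).aestronglyMeasurable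
    (Filter.Eventually.of_forall hC)

/-! ### Boundedness of the pairing -/

/-- Passing from differences to child values turns this into the sequence estimate
`tsum_mul_volume_le`. -/
lemma tsum_enorm_integral_diff_le {p q : ℝ} (hpq : q.HolderConjugate p) (f g : Formal 𝕜 L)
    (hg : g.bmoENorm p ≠ ∞) :
    ∑' I : L.Cell, ‖∫ x, f.diff I x * g.diff I x‖ₑ ≤
      4 * f.hardyENorm q * g.bmoENorm p := by
  have hN : carlesonENorm p g.childValue ≤ g.bmoENorm p := le_max_left _ _
  calc ∑' I : L.Cell, ‖∫ x, f.diff I x * g.diff I x‖ₑ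
      ≤ ∑' I : L.Cell, ∫⁻ x, ‖f.diff I x‖ₑ * ‖g.diff I x‖ₑ := by
        refine ENNReal.tsum_le_tsum fun I => (enorm_integral_le_lintegral_enorm _).trans_eq ?_
        simp_rw [enorm_mul]
    _ = ∫⁻ x, ∑' J : L.Cell,
          J.1.indicator (fun _ => ‖f.childValue J‖ₑ * ‖g.childValue J‖ₑ) x := by
        refine (lintegral_tsum (f := fun (I : L.Cell) x => ‖f.diff I x‖ₑ * ‖g.diff I x‖ₑ)
          fun I => (f.measurable_diff I).enorm.mul (g.measurable_diff I).enorm).symm.trans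
          (lintegral_congr fun x => ?_)
        exact f.tsum_apply_diff (fun a b => ‖a‖ₑ * ‖b‖ₑ) (by simp) g x
    _ = ∑' J : L.Cell, ‖f.childValue J‖ₑ * ‖g.childValue J‖ₑ * volume J.1 := by
        rw [lintegral_tsum fun J => (measurable_const.indicator
          (IntervalLattice.cell_measurable J)).aemeasurable]
        exact tsum_congr fun J => lintegral_indicator_const (IntervalLattice.cell_measurable J) _
    _ ≤ 4 * (∫⁻ x, (∑' J : L.Cell, J.1.indicator (fun _ => ‖f.childValue J‖ₑ ^ q) x) ^ (1 / q)) *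
        carlesonENorm p g.childValue :=
        tsum_mul_volume_le hpq _ _ (ne_top_of_le_ne_top hg hN)
    _ ≤ _ := by
        gcongr
        refine lintegral_mono fun x => ENNReal.rpow_le_rpow ?_ (by simp [hpq.pos.le])
        -- The child values give exactly the difference part of the square function; the mean part
        -- is then added for free. Here `g` only fills the second slot.
        rw [← f.tsum_apply_diff (fun a _ => ‖a‖ₑ ^ q) (by simp [hpq.pos]) g x]
        exact le_self_add

/-- Tail atoms are disjoint, so at each point at most one mean term is nonzero and their sum is
dominated by the square function. -/
lemma tsum_enorm_integral_mean_le {p q : ℝ} (hq : 0 < q) (f g : Formal 𝕜 L) :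
    ∑' I : L.TopFin, ‖∫ x, f.mean I x * g.mean I x‖ₑ ≤ f.hardyENorm q * g.bmoENorm p := by
  have hN : ∀ I x, ‖g.mean I x‖ₑ ≤ g.bmoENorm p := fun I x =>
    (le_iSup₂ (f := fun (I : L.TopFin) (x : ℝ) => ‖g.mean I x‖ₑ) I x).trans (le_max_right _ _)
  calc ∑' I : L.TopFin, ‖∫ x, f.mean I x * g.mean I x‖ₑ
      ≤ ∑' I : L.TopFin, (∫⁻ x, ‖f.mean I x‖ₑ) * g.bmoENorm p := by
        refine ENNReal.tsum_le_tsum fun I => (enorm_integral_le_lintegral_enorm _).trans ?_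
        rw [← lintegral_mul_const _ (f.measurable_mean I).enorm]
        refine lintegral_mono fun x => ?_
        rw [enorm_mul]
        gcongr
        exact hN I x
    _ = (∫⁻ x, ∑' I : L.TopFin, ‖f.mean I x‖ₑ) * g.bmoENorm p := by
        rw [ENNReal.tsum_mul_right, lintegral_tsum fun I => (f.measurable_mean I).enorm.aemeasurable]
    _ ≤ _ := by
        gcongr
        refine lintegral_mono fun x => ?_
        by_cases h : ∃ I : L.TopFin, x ∈ I.1
        · obtain ⟨I, hx⟩ := h
          rw [tsum_eq_single I]
          · rw [one_div, ENNReal.le_rpow_inv_iff hq]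
            exact (ENNReal.le_tsum (f := fun I : L.TopFin => ‖f.mean I x‖ₑ ^ q) I).trans
              le_add_self
          · intro K hK
            obtain ⟨c, hc⟩ := f.exists_mean_eq K
            rw [hc, indicator_of_notMem, enorm_zero]
            exact fun hxK => hK (Subtype.ext
              (IntervalLattice.IsTop.eq_of_mem K.2.1 I.2.1 hxK hx))
        · push Not at h
          have : ∀ I : L.TopFin, f.mean I x = 0 := by
            intro I
            obtain ⟨c, hc⟩ := f.exists_mean_eq I
            rw [hc, indicator_of_notMem (h I)]
          simp [this]

/-- The constant is 4 from the differences plus 1 from the mean terms. Absolute summability over the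
joint index gives the unconditional convergence of both series. -/
lemma tsum_enorm_integral_comp_le {p q : ℝ} (hpq : q.HolderConjugate p) (f g : Formal 𝕜 L)
    (hg : g.bmoENorm p ≠ ∞) :
    ∑' z, ‖∫ x, f.comp z x * g.comp z x‖ₑ ≤ 5 * f.hardyENorm q * g.bmoENorm p := by
  have h := add_le_add (tsum_enorm_integral_diff_le hpq f g hg)
    (tsum_enorm_integral_mean_le (p := p) hpq.pos f g)
  rw [tsum_add_tsum] at h
  refine (le_of_eq ?_).trans (h.trans_eq (by ring))
  exact tsum_congr fun z => by cases z <;> rfl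

lemma summable_integral_comp {p q : ℝ} (hpq : q.HolderConjugate p) {f g : Formal 𝕜 L}
    (hf : f.hardyENorm q ≠ ∞) (hg : g.bmoENorm p ≠ ∞) :
    Summable fun z => ∫ x, f.comp z x * g.comp z x := by
  have h := ne_top_of_le_ne_top (by finiteness) (tsum_enorm_integral_comp_le hpq f g hg)
  refine Summable.of_norm ?_
  simpa using ENNReal.summable_toReal h

lemma hasPairing_tsum {f g : Formal 𝕜 L}
    (h : Summable fun z => ∫ x, f.comp z x * g.comp z x) :
    HasPairing f g (∑' z, ∫ x, f.comp z x * g.comp z x) := by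
  have h1 := h.comp_injective Sum.inl_injective
  have h2 := h.comp_injective Sum.inr_injective
  exact ⟨_, _, h1.hasSum, h2.hasSum, (h1.hasSum.sum h2.hasSum).tsum_eq⟩

end Formal

/-! ### The pairing as a bounded bilinear map -/

section pairing

variable {p q : ℝ} [Fact (1 ≤ q)] [Fact (1 ≤ p)]

lemma extHardy_norm_def (f : ExtHardy 𝕜 L q) : ‖f‖ = (f.1.hardyENorm q).toReal := rfl

lemma extBMO_norm_def (g : ExtBMO 𝕜 L p) : ‖g‖ = (g.1.bmoENorm p).toReal := rfl

lemma ExtHardy.hardyENorm_ne_top (f : ExtHardy 𝕜 L q) : f.1.hardyENorm q ≠ ∞ := f.2.ne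

variable (𝕜 L) in
/-- The pairing of the extended BMO and Hardy spaces. -/
def pairing (hpq : q.HolderConjugate p) : ExtBMO 𝕜 L p →L[𝕜] StrongDual 𝕜 (ExtHardy 𝕜 L q) :=
  LinearMap.mkContinuous₂
    (LinearMap.mk₂ 𝕜 (fun (g : ExtBMO 𝕜 L p) (f : ExtHardy 𝕜 L q) =>
      ∑' z, ∫ x, f.1.comp z x * g.1.comp z x)
      (fun g g' f => by
        rw [← (Formal.summable_integral_comp hpq f.2.ne g.2.ne).tsum_add
          (Formal.summable_integral_comp hpq f.2.ne g'.2.ne)]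
        refine tsum_congr fun z => ?_
        rw [← integral_add (f.1.integrable_comp_mul g.1 z) (f.1.integrable_comp_mul g'.1 z)]
        refine integral_congr_ae (Filter.Eventually.of_forall fun x => ?_)
        simp [Formal.comp_add, mul_add])
      (fun c g f => by
        rw [smul_eq_mul, ← tsum_mul_left]
        refine tsum_congr fun z => ?_
        rw [← integral_const_mul]
        refine integral_congr_ae (Filter.Eventually.of_forall fun x => ?_)
        simp [Formal.comp_smul, mul_left_comm])
      (fun g f f' => by
        rw [← (Formal.summable_integral_comp hpq f.2.ne g.2.ne).tsum_add
          (Formal.summable_integral_comp hpq f'.2.ne g.2.ne)]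
        refine tsum_congr fun z => ?_
        rw [← integral_add (f.1.integrable_comp_mul g.1 z) (f'.1.integrable_comp_mul g.1 z)]
        refine integral_congr_ae (Filter.Eventually.of_forall fun x => ?_)
        simp [Formal.comp_add, add_mul])
      (fun c g f => by
        rw [smul_eq_mul, ← tsum_mul_left]
        refine tsum_congr fun z => ?_
        rw [← integral_const_mul]
        refine integral_congr_ae (Filter.Eventually.of_forall fun x => ?_)
        simp [Formal.comp_smul, mul_assoc])) 5 (fun g f => by
      have h := Formal.tsum_enorm_integral_comp_le hpq f.1 g.1 g.2.ne
      have h1 := (enorm_tsum_le_tsum_enorm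
        (f := fun z => ∫ x, f.1.comp z x * g.1.comp z x)).trans h
      have hf : f.1.hardyENorm q ≠ ∞ := f.2.ne
      have hg : g.1.bmoENorm p ≠ ∞ := g.2.ne
      have h2 := ENNReal.toReal_mono (by finiteness) h1
      rw [toReal_enorm, ENNReal.toReal_mul, ENNReal.toReal_mul] at h2
      refine h2.trans_eq ?_
      rw [extHardy_norm_def, extBMO_norm_def, ENNReal.toReal_ofNat]
      ring)

lemma pairing_apply (hpq : q.HolderConjugate p) (g : ExtBMO 𝕜 L p) (f : ExtHardy 𝕜 L q) :
    pairing 𝕜 L hpq g f = ∑' z, ∫ x, f.1.comp z x * g.1.comp z x := rfl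

lemma hasPairing_pairing (hpq : q.HolderConjugate p) (g : ExtBMO 𝕜 L p) (f : ExtHardy 𝕜 L q) :
    HasPairing f.1 g.1 (pairing 𝕜 L hpq g f) :=
  Formal.hasPairing_tsum (Formal.summable_integral_comp hpq f.2.ne g.2.ne)

lemma norm_pairing_le (hpq : q.HolderConjugate p) (g : ExtBMO 𝕜 L p) :
    ‖pairing 𝕜 L hpq g‖ ≤ 5 * ‖g‖ :=
  ((pairing 𝕜 L hpq).le_opNorm g).trans (by
    gcongr
    exact LinearMap.mkContinuous₂_norm_le _ (by norm_num) _)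

end pairing

end MartingaleBMO

end

noncomputable section

namespace MartingaleBMO

variable {𝕜 : Type*} [RCLike 𝕜] {X : Set ℝ} {L : IntervalLattice X}

/-! ### Truncations -/

namespace Formal

lemma comp_sub (f g : Formal 𝕜 L) (z) : (f - g).comp z = f.comp z - g.comp z := by
  cases z <;> rfl

open Classical in
/-- The finite part of `f` with components in `S`. -/
def trunc (S : Finset (L.Cell ⊕ L.TopFin)) (f : Formal 𝕜 L) : Formal 𝕜 L :=
  (fun I => if Sum.inl I ∈ S then f.1 I else 0, fun I => if Sum.inr I ∈ S then f.2 I else 0)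

open Classical in
lemma comp_trunc (S : Finset (L.Cell ⊕ L.TopFin)) (f : Formal 𝕜 L) (z) :
    (f.trunc S).comp z = if z ∈ S then f.comp z else 0 := by
  rcases z with I | I
  · change ((if Sum.inl I ∈ S then f.1 I else 0 : diffSpace 𝕜 L I.1) : ℝ → 𝕜) = _
    split_ifs <;> rfl
  · change ((if Sum.inr I ∈ S then f.2 I else 0 : meanSpace 𝕜 I.1) : ℝ → 𝕜) = _
    split_ifs <;> rfl

open Classical in
lemma trunc_insert {S : Finset (L.Cell ⊕ L.TopFin)} {z} (hz : z ∉ S) (f : Formal 𝕜 L) :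
    f.trunc (insert z S) = f.trunc {z} + f.trunc S := by
  refine ext_comp fun y => ?_
  simp only [comp_add, comp_trunc, Finset.mem_insert, Finset.mem_singleton]
  by_cases hy : y = z
  · subst hy
    simp [hz]
  · simp [hy]

open Classical in
lemma tsum_comp_trunc {q : ℝ} (hq : 0 < q) (S : Finset (L.Cell ⊕ L.TopFin)) (f : Formal 𝕜 L)
    (x : ℝ) : ∑' z, ‖(f.trunc S).comp z x‖ₑ ^ q = ∑ z ∈ S, ‖f.comp z x‖ₑ ^ q := by
  rw [tsum_eq_sum (s := S)]
  · exact Finset.sum_congr rfl fun z hz => by rw [comp_trunc, if_pos hz]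
  · intro z hz
    rw [comp_trunc, if_neg hz]
    simp [hq]

lemma hardyENorm_trunc_singleton {q : ℝ} (hq : 0 < q) (z) (f : Formal 𝕜 L) :
    (f.trunc {z}).hardyENorm q = ∫⁻ x, ‖f.comp z x‖ₑ := by
  rw [hardyENorm_eq]
  refine lintegral_congr fun x => ?_
  rw [tsum_comp_trunc hq, Finset.sum_singleton, ← ENNReal.rpow_mul, mul_one_div_cancel hq.ne',
    ENNReal.rpow_one]

end Formal

section

variable {q : ℝ} [hq1 : Fact (1 ≤ q)]

/-- Each single component is integrable, so no finiteness of the norm of `f` is needed. -/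
lemma trunc_mem (S : Finset (L.Cell ⊕ L.TopFin)) (f : Formal 𝕜 L) :
    f.trunc S ∈ ExtHardy 𝕜 L q := by
  classical
  have hq0 : 0 < q := by linarith [hq1.out]
  induction S using Finset.induction_on with
  | empty =>
    convert (ExtHardy 𝕜 L q).zero_mem
    exact Formal.ext_comp fun z => by rw [Formal.comp_trunc]; cases z <;> rfl
  | insert z S hz ih =>
    rw [Formal.trunc_insert hz]
    refine add_mem ?_ ih
    change Formal.hardyENorm q _ < ∞
    rw [Formal.hardyENorm_trunc_singleton hq0]
    exact (f.integrable_comp z).2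

variable (q) in
/-- The truncations as elements of the Hardy space. -/
def ExtHardy.trunc (S : Finset (L.Cell ⊕ L.TopFin)) (f : Formal 𝕜 L) : ExtHardy 𝕜 L q :=
  ⟨f.trunc S, trunc_mem S f⟩

/-- Dominated convergence: the square function `F` of `f` is an integrable majorant, and where it is
finite the tails of its series tend to 0. -/
lemma ExtHardy.tendsto_trunc (f : ExtHardy 𝕜 L q) :
    Filter.Tendsto (fun S => ExtHardy.trunc q S f.1) Filter.atTop (nhds f) := by
  classical
  have hq0 : 0 < q := by linarith [hq1.out]
  rw [tendsto_iff_norm_sub_tendsto_zero]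
  let F : ℝ → ℝ≥0∞ := fun x => (∑' z, ‖f.1.comp z x‖ₑ ^ q) ^ (1 / q)
  let G : Finset (L.Cell ⊕ L.TopFin) → ℝ → ℝ≥0∞ := fun S x =>
    (∑' z, ‖(f.1 - f.1.trunc S).comp z x‖ₑ ^ q) ^ (1 / q)
  have hFi : ∫⁻ x, F x ≠ ∞ := by
    have := ExtHardy.hardyENorm_ne_top f
    rwa [Formal.hardyENorm_eq] at this
  have hm : ∀ f : Formal 𝕜 L, AEMeasurable fun x => (∑' z, ‖f.comp z x‖ₑ ^ q) ^ (1 / q) :=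
    fun f => (AEMeasurable.tsum fun z =>
      (f.integrable_comp z).aestronglyMeasurable.enorm.pow_const q).pow_const _
  have hG : ∀ S x, G S x = (∑' z : {z // z ∉ S}, ‖f.1.comp z x‖ₑ ^ q) ^ (1 / q) := by
    intro S x
    simp only [G]
    congr 1
    refine Eq.trans ?_ (tsum_subtype {z | z ∉ S} fun z => ‖f.1.comp z x‖ₑ ^ q).symm
    refine tsum_congr fun z => ?_
    rw [Formal.comp_sub, Formal.comp_trunc]
    by_cases hz : z ∈ S <;> simp [hz, hq0]
  have hlim : Filter.Tendsto (fun S => ∫⁻ x, G S x) Filter.atTop (nhds (∫⁻ _ : ℝ, 0)) := by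
    refine tendsto_lintegral_filter_of_dominated_convergence' F
      (Filter.Eventually.of_forall fun S => hm _)
      (Filter.Eventually.of_forall fun S => Filter.Eventually.of_forall fun x => ?_) hFi ?_
    · rw [hG]
      refine ENNReal.rpow_le_rpow ?_ (by positivity)
      exact ENNReal.tsum_comp_le_tsum_of_injective Subtype.val_injective
        fun z => ‖f.1.comp z x‖ₑ ^ q
    · filter_upwards [ae_lt_top' (hm f.1) hFi] with x hx
      simp_rw [hG]
      have h0 : (0 : ℝ≥0∞) = 0 ^ (1 / q) := by simp [hq0]
      rw [h0]
      refine Filter.Tendsto.ennrpow_const _ (ENNReal.tendsto_tsum_compl_atTop_zero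
        (f := fun z => ‖f.1.comp z x‖ₑ ^ q) ?_)
      have h1 := hx.ne
      intro h
      rw [h] at h1
      exact h1 (ENNReal.top_rpow_of_pos (by positivity))
  rw [lintegral_zero] at hlim
  have h2 := (ENNReal.tendsto_toReal ENNReal.zero_ne_top).comp hlim
  refine h2.congr fun S => ?_
  rw [norm_sub_rev, extHardy_norm_def, Formal.hardyENorm_eq]
  rfl

/-! ### Functionals represented by formal decompositions -/

/-- The functional `Φ` is given on elementary decompositions by the pairing with `g`. -/
def Represents (Φ : StrongDual 𝕜 (ExtHardy 𝕜 L q)) (g : Formal 𝕜 L) : Prop :=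
  ∀ z f, Φ (ExtHardy.trunc q {z} f) = ∫ x, f.comp z x * g.comp z x

lemma Represents.apply_trunc {Φ : StrongDual 𝕜 (ExtHardy 𝕜 L q)} {g : Formal 𝕜 L}
    (h : Represents Φ g) (S : Finset (L.Cell ⊕ L.TopFin)) (f : Formal 𝕜 L) :
    Φ (ExtHardy.trunc q S f) = ∑ z ∈ S, ∫ x, f.comp z x * g.comp z x := by
  classical
  induction S using Finset.induction_on with
  | empty =>
    have : ExtHardy.trunc q ∅ f = 0 := Subtype.ext <| Formal.ext_comp fun z => by
      cases z <;> exact Formal.comp_trunc ∅ f _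
    rw [this, map_zero, Finset.sum_empty]
  | insert z S hz ih =>
    have : ExtHardy.trunc q (insert z S) f = ExtHardy.trunc q {z} f + ExtHardy.trunc q S f :=
      Subtype.ext (Formal.trunc_insert hz f)
    rw [this, map_add, Finset.sum_insert hz, h, ih]

/-- Both functionals agree on truncations, which are dense. -/
lemma Represents.unique {Φ Ψ : StrongDual 𝕜 (ExtHardy 𝕜 L q)} {g : Formal 𝕜 L}
    (h : Represents Φ g) (h' : Represents Ψ g) : Φ = Ψ := by
  ext f
  have h1 := (Φ.continuous.tendsto f).comp (ExtHardy.tendsto_trunc f)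
  have h2 := (Ψ.continuous.tendsto f).comp (ExtHardy.tendsto_trunc f)
  refine tendsto_nhds_unique h1 (h2.congr fun S => ?_)
  simp only [Function.comp_apply]
  rw [h.apply_trunc, h'.apply_trunc]

lemma represents_pairing {p : ℝ} [Fact (1 ≤ p)] (hpq : q.HolderConjugate p)
    (g : ExtBMO 𝕜 L p) : Represents (pairing 𝕜 L hpq g) g.1 := by
  classical
  intro z f
  rw [pairing_apply, tsum_eq_single z]
  · change ∫ x, (f.trunc {z}).comp z x * _ = _
    simp [Formal.comp_trunc]
  · intro y hy
    change ∫ x, (f.trunc {z}).comp y x * _ = _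
    simp [Formal.comp_trunc, hy]

lemma enorm_apply_le (Φ : StrongDual 𝕜 (ExtHardy 𝕜 L q)) (f : ExtHardy 𝕜 L q) :
    ‖Φ f‖ₑ ≤ ‖Φ‖ₑ * f.1.hardyENorm q := by
  have h := ENNReal.ofReal_le_ofReal (Φ.le_opNorm f)
  rwa [ENNReal.ofReal_mul (norm_nonneg _), extHardy_norm_def,
    ENNReal.ofReal_toReal (ExtHardy.hardyENorm_ne_top f), ofReal_norm, ofReal_norm] at h

end

/-! ### Centering -/

/-- `w` minus its mean over `K`. -/
def centered (K : Set ℝ) (w : ℝ → 𝕜) : ℝ → 𝕜 :=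
  w - K.indicator fun _ => (((volume K).toReal : ℝ) : 𝕜)⁻¹ * ∫ y, w y

lemma centered_mem {K : L.Cell} {w : ℝ → 𝕜}
    (hw : ∀ J, L.IsChild J K.1 → ∀ x ∈ J, ∀ y ∈ J, w x = w y)
    (hw0 : ∀ x, (∀ J, L.IsChild J K.1 → x ∉ J) → w x = 0) (hi : Integrable w) :
    centered K.1 w ∈ diffSpace 𝕜 L K.1 := by
  have hKm := IntervalLattice.cell_measurable K
  have hi' : Integrable (K.1.indicator fun _ => (((volume K.1).toReal : ℝ) : 𝕜)⁻¹ * ∫ y, w y) :=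
    (integrable_indicator_iff hKm).2 (integrableOn_const (IntervalLattice.cell_volume_ne_top K))
  refine ⟨fun J hJ x hx y hy => ?_, fun x hx => ?_, hi.sub hi', ?_⟩
  · simp [centered, hw J hJ x hx y hy, hJ.subset hx, hJ.subset hy]
  -- Children cover K as soon as there is one. A point of K outside all children therefore means
  -- that K has none, and then w = 0.
  · by_cases hxK : x ∈ K.1
    · have hno : ∀ J, ¬ L.IsChild J K.1 := fun J hJ => by
        obtain ⟨J', hJ', hx'⟩ := hJ.exists_of_mem hxK
        exact hx J' hJ' hx'
      have h0 : w = 0 := funext fun y => hw0 y fun J hJ => absurd hJ (hno J)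
      simp [centered, h0]
    · simp [centered, hw0 x hx, hxK]
  · have hv : (((volume K.1).toReal : ℝ) : 𝕜) ≠ 0 := by
      rw [RCLike.ofReal_ne_zero]
      exact (ENNReal.toReal_pos (IntervalLattice.cell_volume_pos K).ne'
        (IntervalLattice.cell_volume_ne_top K)).ne'
    unfold centered
    rw [integral_sub' hi hi', integral_indicator_const _ hKm, RCLike.real_smul_eq_coe_mul,
      Measure.real, mul_inv_cancel_left₀ hv, sub_self]

/-- Centering subtracts a constant on K, and Δ_K g has integral 0. Test functions may thus be made
mean-free without changing the pairing. -/
lemma integral_centered_mul (g : Formal 𝕜 L) (K : L.Cell) {w : ℝ → 𝕜} (hi : Integrable w) :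
    ∫ x, centered K.1 w x * g.diff K x = ∫ x, w x * g.diff K x := by
  set c : 𝕜 := (((volume K.1).toReal : ℝ) : 𝕜)⁻¹ * ∫ y, w y with hc
  have h1 : ∀ x, centered K.1 w x * g.diff K x = w x * g.diff K x - c * g.diff K x := by
    intro x
    by_cases hx : x ∈ K.1
    · simp [centered, hx, sub_mul, hc]
    · simp [g.diff_apply_eq_zero K hx]
  have hg : Integrable (g.diff K) := g.integrable_comp (.inl K)
  have hg0 : ∫ x, g.diff K x = 0 := (g.1 K).2.2.2.2
  obtain ⟨C, hC⟩ := g.exists_bound_comp (.inl K)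
  simp_rw [h1]
  rw [integral_sub (hi.mul_bdd hg.aestronglyMeasurable (Filter.Eventually.of_forall hC))
    (hg.const_mul c), integral_const_mul, hg0, mul_zero, sub_zero]

/-- Taking the mean over K is a contraction on L^r by Hölder: the powers of |K| are -1, 1 - 1/r and
1/r, which cancel. -/
lemma eLpNorm_centered_le (K : L.Cell) {w : ℝ → 𝕜} (hi : Integrable w)
    (hw0 : ∀ x, x ∉ K.1 → w x = 0) {r : ℝ≥0∞} (hr : 1 ≤ r) (hrt : r ≠ ∞) :
    eLpNorm (centered K.1 w) r ≤ 2 * eLpNorm w r := by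
  have hKm := IntervalLattice.cell_measurable K
  have hv0 := (IntervalLattice.cell_volume_pos K).ne'
  have hvt := IntervalLattice.cell_volume_ne_top K
  have hr0 : r ≠ 0 := (zero_lt_one.trans_le hr).ne'
  have hwr : ∀ s, eLpNorm w s (volume.restrict K.1) = eLpNorm w s := by
    intro s
    rw [← eLpNorm_indicator_eq_eLpNorm_restrict hKm]
    congr 1
    ext x
    by_cases hx : x ∈ K.1 <;> simp [hx, hw0]
  have h1 : eLpNorm w 1 ≤ eLpNorm w r * volume K.1 ^ (1 - 1 / r.toReal) := by
    have := eLpNorm_le_eLpNorm_mul_rpow_measure_univ (μ := volume.restrict K.1) hr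
      hi.aestronglyMeasurable.restrict
    simpa [hwr] using this
  unfold centered
  have h2 : ‖(((volume K.1).toReal : ℝ) : 𝕜)⁻¹ * ∫ y, w y‖ₑ ≤
      (volume K.1)⁻¹ * (eLpNorm w r * volume K.1 ^ (1 - 1 / r.toReal)) := by
    rw [enorm_mul]
    refine mul_le_mul' (le_of_eq ?_) ?_
    · rw [enorm_inv (by simp [ENNReal.toReal_eq_zero_iff, hv0, hvt]), ← ofReal_norm,
        RCLike.norm_ofReal, abs_of_nonneg ENNReal.toReal_nonneg, ENNReal.ofReal_toReal hvt]
    · refine le_trans (enorm_integral_le_lintegral_enorm _) ?_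
      rwa [← eLpNorm_one_eq_lintegral_enorm]
  generalize (((volume K.1).toReal : ℝ) : 𝕜)⁻¹ * ∫ y, w y = c at h2 ⊢
  refine (eLpNorm_sub_le hi.aestronglyMeasurable
    (aestronglyMeasurable_const.indicator hKm) hr).trans ?_
  rw [two_mul, eLpNorm_indicator_const hKm hr0 hrt]
  refine add_le_add le_rfl ((mul_le_mul_left h2 _).trans_eq ?_)
  have key : ∀ a b c d : ℝ≥0∞, a * (b * c) * d = a * (c * d) * b := fun a b c d => by ring
  rw [key, ← ENNReal.rpow_add _ _ hv0 hvt, sub_add_cancel, ENNReal.rpow_one,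
    ENNReal.inv_mul_cancel hv0 hvt, one_mul]

end MartingaleBMO

end

noncomputable section

namespace MartingaleBMO

variable {𝕜 : Type*} [RCLike 𝕜] {X : Set ℝ} {L : IntervalLattice X}

/-! ### The lower bound for the norm of a functional -/

lemma integrable_of_const_on_children {K : L.Cell} {w : ℝ → 𝕜}
    (hw : ∀ J, L.IsChild J K.1 → ∀ x ∈ J, ∀ y ∈ J, w x = w y)
    (hw0 : ∀ x, (∀ J, L.IsChild J K.1 → x ∉ J) → w x = 0) : Integrable w := by
  classical
  let F := (IntervalLattice.finite_children (L := L) K.1).toFinset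
  have hF : ∀ J, J ∈ F ↔ L.IsChild J K.1 := fun J => by simp [F]
  have h : w = fun x => ∑ J ∈ F, J.indicator (fun _ => w (sInf J)) x := by
    funext x
    by_cases hx : ∃ J, L.IsChild J K.1 ∧ x ∈ J
    · obtain ⟨J, hJ, hx⟩ := hx
      rw [Finset.sum_eq_single J, indicator_of_mem hx]
      · exact hw J hJ x hx _ (IntervalLattice.cell_sInf_mem ⟨J, hJ.cell⟩)
      · intro J' hJ' hne
        exact indicator_of_notMem (fun hx' => hne (((hF J').1 hJ').eq_of_mem hJ hx' hx)) _
      · intro hn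
        exact absurd ((hF J).2 hJ) hn
    · push Not at hx
      rw [hw0 x hx, Finset.sum_eq_zero]
      intro J hJ
      exact indicator_of_notMem (hx J ((hF J).1 hJ)) _
  rw [h]
  refine integrable_finsetSum _ fun J hJ => ?_
  have hc := ((hF J).1 hJ).cell
  rw [integrable_indicator_iff (IntervalLattice.cell_measurable ⟨J, hc⟩)]
  exact integrableOn_const (IntervalLattice.cell_volume_ne_top ⟨J, hc⟩)

/-- The function `z ↦ conj z * |z| ^ (p - 2)`, whose product with `z` is `|z| ^ p`. -/
def dualPower (p : ℝ) (z : 𝕜) : 𝕜 := (starRingEnd 𝕜) z * ((‖z‖ ^ (p - 2) : ℝ) : 𝕜)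

@[simp] lemma dualPower_zero (p : ℝ) : dualPower p (0 : 𝕜) = 0 := by simp [dualPower]

lemma dualPower_mul {p : ℝ} (hp : 0 < p) (z : 𝕜) : dualPower p z * z = ((‖z‖ ^ p : ℝ) : 𝕜) := by
  by_cases hz : z = 0
  · simp [hz, hp.ne']
  have h : ‖z‖ ^ p = ‖z‖ ^ 2 * ‖z‖ ^ (p - 2) := by
    rw [← Real.rpow_natCast, ← Real.rpow_add (norm_pos_iff.2 hz)]
    congr 1
    push_cast
    ring
  rw [dualPower, mul_right_comm, RCLike.conj_mul, h]
  push_cast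
  rfl

lemma norm_dualPower {p : ℝ} (hp : 1 < p) (z : 𝕜) : ‖dualPower p z‖ = ‖z‖ ^ (p - 1) := by
  by_cases hz : z = 0
  · simp [hz, Real.zero_rpow (sub_pos.2 hp).ne']
  rw [dualPower, norm_mul, RCLike.norm_conj, RCLike.norm_ofReal, abs_of_nonneg (by positivity)]
  nth_rw 1 [← Real.rpow_one ‖z‖]
  rw [← Real.rpow_add (norm_pos_iff.2 hz)]
  congr 1
  ring

lemma enorm_dualPower_rpow {p q : ℝ} (hpq : q.HolderConjugate p) (z : 𝕜) :
    ‖dualPower p z‖ₑ ^ q = ‖z‖ₑ ^ p := by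
  rw [← ofReal_norm, ← ofReal_norm, norm_dualPower hpq.symm.lt,
    ← ENNReal.ofReal_rpow_of_nonneg (norm_nonneg z) (by linarith [hpq.symm.lt]),
    ← ENNReal.rpow_mul, hpq.symm.sub_one_mul_conj]

/-- The decomposition with differences `centered K (w K)`. -/
def centeredFormal (w : L.Cell → ℝ → 𝕜) (h : ∀ K, centered K.1 (w K) ∈ diffSpace 𝕜 L K.1) :
    Formal 𝕜 L :=
  (fun K => ⟨_, h K⟩, 0)

lemma lintegral_rpow_centered_le {K : L.Cell} {w : ℝ → 𝕜} (hi : Integrable w)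
    (hw0 : ∀ x, x ∉ K.1 → w x = 0) {r : ℝ} (hr : 1 ≤ r) :
    ∫⁻ x, ‖centered K.1 w x‖ₑ ^ r ≤ 2 ^ r * ∫⁻ x, ‖w x‖ₑ ^ r := by
  have hr0 : 0 < r := by linarith
  have h := eLpNorm_centered_le K hi hw0 (r := ENNReal.ofReal r) (by simpa using hr)
    ENNReal.ofReal_ne_top
  have hne : ENNReal.ofReal r ≠ 0 := by simpa using hr0
  rw [eLpNorm_eq_lintegral_rpow_enorm_toReal hne ENNReal.ofReal_ne_top,
    eLpNorm_eq_lintegral_rpow_enorm_toReal hne ENNReal.ofReal_ne_top,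
    ENNReal.toReal_ofReal hr0.le] at h
  have h2 := ENNReal.rpow_le_rpow h hr0.le
  rwa [ENNReal.mul_rpow_of_nonneg _ _ hr0.le, ← ENNReal.rpow_mul, ← ENNReal.rpow_mul,
    one_div_mul_cancel hr0.ne', ENNReal.rpow_one, ENNReal.rpow_one] at h2

section

variable {q : ℝ} [hq1 : Fact (1 ≤ q)] {Φ : StrongDual 𝕜 (ExtHardy 𝕜 L q)} {g : Formal 𝕜 L}

/-- Tested on the indicator of T, whose Hardy norm is |T|. -/
lemma Represents.enorm_mean_le (h : Represents Φ g) (T : L.TopFin) (x : ℝ) :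
    ‖g.mean T x‖ₑ ≤ ‖Φ‖ₑ := by
  have hq0 : 0 < q := by linarith [hq1.out]
  obtain ⟨c, hc⟩ := g.exists_mean_eq T
  have hTm := T.2.1.measurable
  have hT0 : volume T.1 ≠ 0 := by
    obtain ⟨J, hJ⟩ := T.2.1.exists_cell
    exact ((IntervalLattice.cell_volume_pos J).trans_le (measure_mono hJ)).ne'
  let f : Formal 𝕜 L := (0, fun T => ⟨T.1.indicator fun _ => 1, 1, rfl⟩)
  have hf : f.comp (.inr T) = T.1.indicator fun _ => (1 : 𝕜) := rfl
  have h1 := h (.inr T) f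
  have h2 := enorm_apply_le Φ (ExtHardy.trunc q {.inr T} f)
  have h3 : (f.trunc {.inr T}).hardyENorm q = volume T.1 := by
    rw [Formal.hardyENorm_trunc_singleton hq0, hf]
    simp_rw [enorm_indicator_eq_indicator_enorm]
    rw [lintegral_indicator_const hTm]
    simp
  have h4 : ∫ x, f.comp (.inr T) x * g.comp (.inr T) x = ((volume T.1).toReal : 𝕜) * c := by
    rw [hf, Formal.comp_inr, hc]
    have : ∀ x, T.1.indicator (fun _ => (1 : 𝕜)) x * T.1.indicator (fun _ => c) x =
        T.1.indicator (fun _ => c) x := fun x => by by_cases hx : x ∈ T.1 <;> simp [hx]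
    simp_rw [this]
    rw [integral_indicator_const _ hTm, RCLike.real_smul_eq_coe_mul]
    rfl
  change _ ≤ ‖Φ‖ₑ * (f.trunc {.inr T}).hardyENorm q at h2
  rw [h1, h3, h4, enorm_mul, ← ofReal_norm, RCLike.norm_ofReal,
    abs_of_nonneg ENNReal.toReal_nonneg, ENNReal.ofReal_toReal T.2.2.ne, mul_comm] at h2
  have h5 := (ENNReal.mul_le_mul_iff_left hT0 T.2.2.ne).1 h2
  rw [hc]
  exact (enorm_indicator_le_enorm_self _ _).trans h5

/-- The test function is the indicator of J centered over the parent P: its norm is at most 2|J|,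
and its pairing with g is |J| x_J(g). -/
lemma Represents.enorm_childValue_le (h : Represents Φ g) (J : L.Cell) :
    ‖g.childValue J‖ₑ ≤ 2 * ‖Φ‖ₑ := by
  classical
  have hq0 : 0 < q := by linarith [hq1.out]
  by_cases hP : ∃ P : L.Cell, L.IsChild J.1 P.1
  swap
  · push Not at hP
    simp [g.childValue_eq_zero hP]
  obtain ⟨P, hP⟩ := hP
  have hJm := IntervalLattice.cell_measurable J
  have hv0 := (IntervalLattice.cell_volume_pos J).ne'
  have hvt := IntervalLattice.cell_volume_ne_top J
  let w : L.Cell → ℝ → 𝕜 := fun K => if L.IsChild J.1 K.1 then J.1.indicator 1 else 0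
  have hwP : w P = J.1.indicator 1 := if_pos hP
  have hw1 : ∀ (K : L.Cell) I, L.IsChild I K.1 → ∀ x ∈ I, ∀ y ∈ I, w K x = w K y := by
    intro K I hI x hx y hy
    by_cases hJ : L.IsChild J.1 K.1
    · have hxy : x ∈ J.1 ↔ y ∈ J.1 := by
        constructor
        · intro hx'; rwa [← hI.eq_of_mem hJ hx hx']
        · intro hy'; rwa [← hI.eq_of_mem hJ hy hy']
      simp [w, hJ, indicator_apply, hxy]
    · simp [w, hJ]
  have hw0 : ∀ (K : L.Cell) x, (∀ I, L.IsChild I K.1 → x ∉ I) → w K x = 0 := by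
    intro K x hx
    by_cases hJ : L.IsChild J.1 K.1
    · simp [w, hJ, hx _ hJ]
    · simp [w, hJ]
  have hi : ∀ K, Integrable (w K) := fun K => integrable_of_const_on_children (hw1 K) (hw0 K)
  let f := centeredFormal w fun K => centered_mem (hw1 K) (hw0 K) (hi K)
  have h1 := h (.inl P) f
  have h2 := enorm_apply_le Φ (ExtHardy.trunc q {.inl P} f)
  have h3 : (f.trunc {.inl P}).hardyENorm q ≤ 2 * volume J.1 := by
    rw [Formal.hardyENorm_trunc_singleton hq0]
    have := lintegral_rpow_centered_le (hi P)
      (fun x hx => hw0 P x fun I hI hxI => hx (hI.subset hxI)) le_rfl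
    simp only [ENNReal.rpow_one] at this
    refine this.trans_eq ?_
    rw [hwP]
    simp_rw [enorm_indicator_eq_indicator_enorm]
    simp [lintegral_indicator_const hJm]
  have h4 : ∫ x, f.comp (.inl P) x * g.comp (.inl P) x =
      ((volume J.1).toReal : 𝕜) * g.childValue J := by
    change ∫ x, centered P.1 (w P) x * g.diff P x = _
    rw [integral_centered_mul g P (hi P), hwP]
    have : ∀ x, J.1.indicator (1 : ℝ → 𝕜) x * g.diff P x =
        J.1.indicator (fun _ => g.childValue J) x := fun x => by
      by_cases hx : x ∈ J.1
      · simp [hx, g.childValue_eq hP hx]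
      · simp [hx]
    simp_rw [this]
    rw [integral_indicator_const _ hJm, RCLike.real_smul_eq_coe_mul]
    rfl
  change _ ≤ ‖Φ‖ₑ * (f.trunc {.inl P}).hardyENorm q at h2
  rw [h1, h4, enorm_mul, ← ofReal_norm, RCLike.norm_ofReal,
    abs_of_nonneg ENNReal.toReal_nonneg, ENNReal.ofReal_toReal hvt, mul_comm] at h2
  have h5 : ‖g.childValue J‖ₑ * volume J.1 ≤ (2 * ‖Φ‖ₑ) * volume J.1 :=
    (h2.trans (mul_le_mul_right h3 _)).trans_eq (by ring)
  exact (ENNReal.mul_le_mul_iff_left hv0 hvt).1 h5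

/-- Absorption: divide by A^(1/q), which requires A finite, and raise to the power p. -/
lemma le_of_le_mul_rpow {p q : ℝ} (hpq : q.HolderConjugate p) {A M V : ℝ≥0∞} (hA : A ≠ ∞)
    (h : A ≤ M * (A ^ (1 / q) * V ^ (1 / p))) : A ≤ M ^ p * V := by
  have hp := hpq.symm.pos
  have hq := hpq.pos
  by_cases h0 : A = 0
  · simp [h0]
  have h1 : A = A ^ (1 / q) * A ^ (1 / p) := by
    rw [← ENNReal.rpow_add _ _ h0 hA, one_div, one_div, hpq.inv_add_inv_eq_one, ENNReal.rpow_one]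
  have h2 : A ^ (1 / q) * A ^ (1 / p) ≤ A ^ (1 / q) * (M * V ^ (1 / p)) := by
    rw [← h1]
    exact h.trans_eq (by ring)
  have h3 : A ^ (1 / p) ≤ M * V ^ (1 / p) := by
    refine (ENNReal.mul_le_mul_iff_right ?_ ?_).1 h2
    · simp [ENNReal.rpow_eq_zero_iff, h0, hA]
    · exact ENNReal.rpow_ne_top_of_nonneg (by positivity) hA
  have h4 := ENNReal.rpow_le_rpow h3 hp.le
  rwa [ENNReal.mul_rpow_of_nonneg _ _ hp.le, ← ENNReal.rpow_mul, ← ENNReal.rpow_mul,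
    one_div_mul_cancel hp.ne', ENNReal.rpow_one, ENNReal.rpow_one] at h4

/-- With A the sum on the left, the centered dual powers give a test function whose pairing with g
is A and whose Hardy norm is at most 2 A^(1/q) |J|^(1/p). Finiteness of S makes A finite, so
`le_of_le_mul_rpow` applies. -/
lemma Represents.sum_lintegral_le {p : ℝ} (hpq : q.HolderConjugate p) (h : Represents Φ g)
    (J : L.Cell) (S : Finset L.Cell) (hS : ∀ K ∈ S, K.1 ⊆ J.1) :
    ∑ K ∈ S, ∫⁻ x, ‖g.diff K x‖ₑ ^ p ≤ (2 * ‖Φ‖ₑ) ^ p * volume J.1 := by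
  classical
  have hp := hpq.symm.pos
  have hq := hpq.pos
  have hJm := IntervalLattice.cell_measurable J
  let w : L.Cell → ℝ → 𝕜 := fun K x => dualPower p (g.diff K x)
  have hw1 : ∀ (K : L.Cell) I, L.IsChild I K.1 → ∀ x ∈ I, ∀ y ∈ I, w K x = w K y :=
    fun K I hI x hx y hy => congrArg (dualPower p) ((g.1 K).2.1 I hI x hx y hy)
  have hw0 : ∀ (K : L.Cell) x, (∀ I, L.IsChild I K.1 → x ∉ I) → w K x = 0 := by
    intro K x hx
    have : g.diff K x = 0 := (g.1 K).2.2.1 x hx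
    simp [w, this]
  have hi : ∀ K, Integrable (w K) := fun K => integrable_of_const_on_children (hw1 K) (hw0 K)
  let f := centeredFormal w fun K => centered_mem (hw1 K) (hw0 K) (hi K)
  have hn : ∀ K, Integrable fun x => ‖g.diff K x‖ ^ p := by
    intro K
    obtain ⟨C, hC⟩ := g.exists_bound_comp (.inl K)
    have h1 := ((hi K).mul_bdd (g.integrable_comp (.inl K)).aestronglyMeasurable
      (Filter.Eventually.of_forall hC)).norm
    refine h1.congr (Filter.Eventually.of_forall fun x => ?_)
    simp only [Formal.comp_inl, w, dualPower_mul hp, RCLike.norm_ofReal]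
    exact abs_of_nonneg (by positivity)
  have hA : ∀ K, ∫⁻ x, ‖g.diff K x‖ₑ ^ p = ENNReal.ofReal (∫ x, ‖g.diff K x‖ ^ p) := by
    intro K
    rw [ofReal_integral_eq_lintegral_ofReal (hn K)
      (Filter.Eventually.of_forall fun x => by positivity)]
    refine lintegral_congr fun x => ?_
    rw [← ofReal_norm, ENNReal.ofReal_rpow_of_nonneg (norm_nonneg _) hp.le]
  set A := ∑ K ∈ S, ∫⁻ x, ‖g.diff K x‖ₑ ^ p with hAdef
  have hAt : A ≠ ∞ := by
    simp only [hAdef, hA]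
    exact ENNReal.sum_ne_top.2 fun K _ => ENNReal.ofReal_ne_top
  let S' : Finset (L.Cell ⊕ L.TopFin) := S.map Function.Embedding.inl
  have h1 : ‖Φ (ExtHardy.trunc q S' f)‖ₑ = A := by
    rw [h.apply_trunc, Finset.sum_map]
    have h2 : ∀ K ∈ S, ∫ x, f.comp (.inl K) x * g.comp (.inl K) x =
        ((∫ x, ‖g.diff K x‖ ^ p : ℝ) : 𝕜) := by
      intro K _
      change ∫ x, centered K.1 (w K) x * g.diff K x = _
      rw [integral_centered_mul g K (hi K), ← integral_ofReal]
      exact integral_congr_ae (Filter.Eventually.of_forall fun x => dualPower_mul hp _)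
    have h3 : ∀ K ∈ S, 0 ≤ ∫ x, ‖g.diff K x‖ ^ p := fun K _ =>
      integral_nonneg fun x => by positivity
    simp only [Function.Embedding.inl_apply]
    rw [Finset.sum_congr rfl h2, ← RCLike.ofReal_sum, ← ofReal_norm, RCLike.norm_ofReal,
      abs_of_nonneg (Finset.sum_nonneg h3), ENNReal.ofReal_sum_of_nonneg h3]
    simp only [hAdef, hA]
  have h4 : (f.trunc S').hardyENorm q ≤ 2 * (A ^ (1 / q) * volume J.1 ^ (1 / p)) := by
    let H : ℝ → ℝ≥0∞ := fun x => ∑ K ∈ S, ‖f.diff K x‖ₑ ^ q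
    have hHm : AEMeasurable H := Finset.aemeasurable_fun_sum _ fun K _ =>
      (f.measurable_diff K).enorm.pow_const q
    have hH0 : ∀ x, x ∉ J.1 → H x = 0 := by
      intro x hx
      refine Finset.sum_eq_zero fun K hK => ?_
      rw [f.diff_apply_eq_zero K fun hxK => hx (hS K hK hxK)]
      simp [hq]
    have hH : ∫⁻ x, H x ≤ 2 ^ q * A := by
      rw [lintegral_finsetSum' _ fun K _ => (f.measurable_diff K).enorm.pow_const q, hAdef,
        Finset.mul_sum]
      refine Finset.sum_le_sum fun K _ => ?_
      refine (lintegral_rpow_centered_le (hi K)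
        (fun x hx => hw0 K x fun I hI hxI => hx (hI.subset hxI)) hpq.lt.le).trans_eq ?_
      simp only [w, enorm_dualPower_rpow hpq]
    -- The square function is supported in J, so the indicator can be inserted and Hölder yields the
    -- factor |J|^(1/p).
    calc (f.trunc S').hardyENorm q = ∫⁻ x, H x ^ (1 / q) * J.1.indicator 1 x := by
          rw [Formal.hardyENorm_eq]
          refine lintegral_congr fun x => ?_
          rw [Formal.tsum_comp_trunc hq, Finset.sum_map]
          by_cases hx : x ∈ J.1
          · simp [hx, H]
          · have := hH0 x hx
            simp only [H] at this
            simp [hx, this, hq, -Finset.sum_eq_zero_iff]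
      _ ≤ (∫⁻ x, (H x ^ (1 / q)) ^ q) ^ (1 / q) *
          (∫⁻ x, (J.1.indicator 1 x) ^ p) ^ (1 / p) :=
          ENNReal.lintegral_mul_le_Lp_mul_Lq _ hpq (hHm.pow_const _)
            (measurable_one.indicator hJm).aemeasurable
      _ = (∫⁻ x, H x) ^ (1 / q) * volume J.1 ^ (1 / p) := by
          congr 2
          · refine lintegral_congr fun x => ?_
            rw [← ENNReal.rpow_mul, one_div_mul_cancel hq.ne', ENNReal.rpow_one]
          · rw [← lintegral_indicator_one hJm]
            refine lintegral_congr fun x => ?_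
            by_cases hx : x ∈ J.1 <;> simp [hx, hp]
      _ ≤ (2 ^ q * A) ^ (1 / q) * volume J.1 ^ (1 / p) := by gcongr
      _ = _ := by
          rw [ENNReal.mul_rpow_of_nonneg _ _ (by positivity), ← ENNReal.rpow_mul,
            mul_one_div_cancel hq.ne', ENNReal.rpow_one, mul_assoc]
  refine le_of_le_mul_rpow hpq hAt ?_
  rw [← h1]
  refine (enorm_apply_le Φ _).trans ((mul_le_mul_right h4 _).trans_eq ?_)
  rw [h1]
  ring

/-- The local sum over I ⊆ J splits into I = J, bounded by the single-value estimate, and I ≠ J,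
whose parents (if any) lie in J, so that these terms are collected into the differences Δ_K g with K
⊆ J. -/
lemma Represents.carlesonENorm_le {p : ℝ} (hpq : q.HolderConjugate p) (h : Represents Φ g) :
    carlesonENorm p g.childValue ≤ 4 * ‖Φ‖ₑ := by
  classical
  have hp := hpq.symm.pos
  refine iSup_le fun J => ?_
  have hv0 := (IntervalLattice.cell_volume_pos J).ne'
  have hvt := IntervalLattice.cell_volume_ne_top J
  have hcm : ∀ I : L.Cell, MeasurableSet I.1 := IntervalLattice.cell_measurable
  set a : L.Cell → ℝ≥0∞ := fun I => ‖g.childValue I‖ₑ ^ p * volume I.1 with ha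
  have h1 : ∫⁻ x in J.1, localSum p g.childValue J x ≤
      ∑' I : L.Cell, if I.1 ⊆ J.1 then a I else 0 := by
    refine (setLIntegral_le_lintegral _ _).trans ?_
    simp_rw [localSum_eq_tsum]
    rw [lintegral_tsum]
    · refine ENNReal.tsum_le_tsum fun I => ?_
      by_cases hI : I ∈ {I : L.Cell | I.1 ⊆ J.1}
      · simp_rw [indicator_of_mem hI]
        rw [if_pos (show I.1 ⊆ J.1 from hI), lintegral_indicator_const (hcm I)]
      · simp_rw [indicator_of_notMem hI]
        simp
    · intro I
      by_cases hI : I ∈ {I : L.Cell | I.1 ⊆ J.1}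
      · simp_rw [indicator_of_mem hI]
        exact (measurable_const.indicator (hcm I)).aemeasurable
      · simp_rw [indicator_of_notMem hI]
        exact aemeasurable_const
  have h2 : ∀ K : L.Cell, ∫⁻ x, ‖g.diff K x‖ₑ ^ p =
      ∑' I : L.Cell, if L.IsChild I.1 K.1 then a I else 0 := by
    intro K
    have := g.apply_diff_eq_tsum (fun z _ => ‖z‖ₑ ^ p) (by simp [hp]) g K
    simp_rw [this]
    rw [lintegral_tsum]
    · refine tsum_congr fun I => ?_
      split_ifs
      · exact lintegral_indicator_const (hcm I) _
      · simp
    · intro I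
      split_ifs
      · exact (measurable_const.indicator (hcm I)).aemeasurable
      · exact aemeasurable_const
  have h3 : ∀ I : L.Cell, (if I.1 ⊆ J.1 then a I else 0) ≤ (if I = J then a I else 0) +
      ∑' K : L.Cell, if K.1 ⊆ J.1 then (if L.IsChild I.1 K.1 then a I else 0) else 0 := by
    intro I
    by_cases hI : I.1 ⊆ J.1
    swap
    · simp [hI]
    rw [if_pos hI]
    by_cases hIJ : I = J
    · rw [if_pos hIJ]
      exact le_self_add
    by_cases hK : ∃ K : L.Cell, L.IsChild I.1 K.1
    · obtain ⟨K, hK⟩ := hK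
      refine le_trans ?_ (le_add_left (ENNReal.le_tsum K))
      rw [if_pos (hK.parent_subset hI hIJ), if_pos hK]
    · push Not at hK
      simp [ha, g.childValue_eq_zero hK, hp]
  have h4 : ∑' K : L.Cell, (if K.1 ⊆ J.1 then ∫⁻ x, ‖g.diff K x‖ₑ ^ p else 0) ≤
      (2 * ‖Φ‖ₑ) ^ p * volume J.1 := by
    refine ENNReal.summable.tsum_le_of_sum_le fun S => ?_
    rw [← Finset.sum_filter]
    exact h.sum_lintegral_le hpq J _ fun K hK => (Finset.mem_filter.1 hK).2
  have h5 : ∫⁻ x in J.1, localSum p g.childValue J x ≤ (4 * ‖Φ‖ₑ) ^ p * volume J.1 := by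
    calc ∫⁻ x in J.1, localSum p g.childValue J x
        ≤ ∑' I : L.Cell, ((if I = J then a I else 0) +
          ∑' K : L.Cell, if K.1 ⊆ J.1 then (if L.IsChild I.1 K.1 then a I else 0) else 0) :=
          h1.trans (ENNReal.tsum_le_tsum h3)
      _ = a J + ∑' K : L.Cell, (if K.1 ⊆ J.1 then ∫⁻ x, ‖g.diff K x‖ₑ ^ p else 0) := by
          rw [ENNReal.tsum_add, tsum_ite_eq, ENNReal.tsum_comm]
          congr 1
          refine tsum_congr fun K => ?_
          split_ifs
          · exact (h2 K).symm
          · simp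
      _ ≤ (2 * ‖Φ‖ₑ) ^ p * volume J.1 + (2 * ‖Φ‖ₑ) ^ p * volume J.1 := by
          refine add_le_add ?_ h4
          simp only [ha]
          gcongr
          exact h.enorm_childValue_le J
      _ = 2 * ((2 * ‖Φ‖ₑ) ^ p * volume J.1) := (two_mul _).symm
      -- The two equal contributions are absorbed by 2 ≤ 2^p, which produces the constant 4.
      _ ≤ 2 ^ p * ((2 * ‖Φ‖ₑ) ^ p * volume J.1) := by
          gcongr
          conv_lhs => rw [← ENNReal.rpow_one 2]
          exact ENNReal.rpow_le_rpow_of_exponent_le (by norm_num) hpq.symm.lt.le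
      _ = _ := by
          rw [← mul_assoc, ← ENNReal.mul_rpow_of_nonneg _ _ hp.le, ← mul_assoc]
          norm_num
  change ((volume J.1)⁻¹ * ∫⁻ x in J.1, localSum p g.childValue J x) ^ (1 / p) ≤ _
  rw [one_div, ENNReal.rpow_inv_le_iff hp, mul_comm, ← div_eq_mul_inv,
    ENNReal.div_le_iff hv0 hvt]
  exact h5

lemma Represents.bmoENorm_le {p : ℝ} (hpq : q.HolderConjugate p) (h : Represents Φ g) :
    g.bmoENorm p ≤ 4 * ‖Φ‖ₑ := by
  refine max_le (h.carlesonENorm_le hpq) (iSup₂_le fun T x => (h.enorm_mean_le T x).trans ?_)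
  exact le_mul_of_one_le_left' (by norm_num)

end

end MartingaleBMO

end

noncomputable section

namespace MartingaleBMO

variable {𝕜 : Type*} [RCLike 𝕜] {X : Set ℝ} {L : IntervalLattice X}

/-! ### Every functional is represented -/

/-- On a finite dimensional space of functions that is closed under conjugation and on which the
integral pairing is defined and nondegenerate, every functional is an integral. -/
lemma exists_integral_eq {V : Submodule 𝕜 (ℝ → 𝕜)} [FiniteDimensional 𝕜 V]
    (hmul : ∀ f ∈ V, ∀ g ∈ V, Integrable fun x => f x * g x)
    (hconj : ∀ f ∈ V, (fun x => (starRingEnd 𝕜) (f x)) ∈ V)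
    (h0 : ∀ f ∈ V, f =ᵐ[volume] 0 → f = 0) (l : V →ₗ[𝕜] 𝕜) :
    ∃ g ∈ V, ∀ h : V, l h = ∫ x, h.1 x * g x := by
  let B : V →ₗ[𝕜] Module.Dual 𝕜 V := LinearMap.mk₂ 𝕜 (fun g h : V => ∫ x, h.1 x * g.1 x)
    (fun g g' h => by
      rw [← integral_add (hmul _ h.2 _ g.2) (hmul _ h.2 _ g'.2)]
      simp [mul_add])
    (fun c g h => by
      rw [smul_eq_mul, ← integral_const_mul]
      simp [mul_left_comm])
    (fun g h h' => by
      rw [← integral_add (hmul _ h.2 _ g.2) (hmul _ h'.2 _ g.2)]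
      simp [add_mul])
    (fun c g h => by
      rw [smul_eq_mul, ← integral_const_mul]
      simp [mul_assoc])
  have hinj : Function.Injective B := by
    rw [injective_iff_map_eq_zero]
    intro g hg
    -- The pairing is bilinear, so positivity is obtained by testing with the conjugate of g.
    have h1 : ∫ x, (starRingEnd 𝕜) (g.1 x) * g.1 x = 0 :=
      LinearMap.congr_fun hg ⟨_, hconj _ g.2⟩
    have hi := (hmul _ (hconj _ g.2) _ g.2).norm
    have h2 : ∀ x, (starRingEnd 𝕜) (g.1 x) * g.1 x = ((‖g.1 x‖ ^ 2 : ℝ) : 𝕜) := fun x => by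
      rw [RCLike.conj_mul]; push_cast; rfl
    simp_rw [h2] at h1 hi
    rw [integral_ofReal, RCLike.ofReal_eq_zero] at h1
    have hi' : Integrable fun x => ‖g.1 x‖ ^ 2 := by simpa using hi
    rw [integral_eq_zero_iff_of_nonneg (fun x => by positivity) hi'] at h1
    refine Subtype.ext (h0 _ g.2 ?_)
    filter_upwards [h1] with x hx
    simpa using hx
  -- An injective map between spaces of equal finite dimension is onto.
  have hsurj : Function.Surjective B :=
    (LinearMap.injective_iff_surjective_of_finrank_eq_finrank Subspace.dual_finrank_eq.symm).1 hinj
  obtain ⟨g, hg⟩ := hsurj l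
  exact ⟨g.1, g.2, fun h => (LinearMap.congr_fun hg h).symm⟩

instance (I : L.Cell) : FiniteDimensional 𝕜 (diffSpace 𝕜 L I.1) := by
  have := (IntervalLattice.finite_children (L := L) I.1).to_subtype
  let e : diffSpace 𝕜 L I.1 →ₗ[𝕜] ({J | L.IsChild J I.1} → 𝕜) :=
    { toFun := fun h J => h.1 (sInf J.1)
      map_add' := fun _ _ => rfl
      map_smul' := fun _ _ => rfl }
  refine Module.Finite.of_injective e ((injective_iff_map_eq_zero e).2 fun h hh => ?_)
  refine Subtype.ext (funext fun x => ?_)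
  by_cases hx : ∃ J, L.IsChild J I.1 ∧ x ∈ J
  · obtain ⟨J, hJ, hxJ⟩ := hx
    have h1 : h.1 (sInf J) = 0 := congrFun hh ⟨J, hJ⟩
    rw [h.2.1 J hJ x hxJ _ (IntervalLattice.cell_sInf_mem ⟨J, hJ.cell⟩), h1]
    rfl
  · push Not at hx
    exact h.2.2.1 x hx

instance (I : L.TopFin) : FiniteDimensional 𝕜 (meanSpace 𝕜 I.1) := by
  obtain ⟨J, hJ⟩ := I.2.1.exists_cell
  have hx := hJ (IntervalLattice.cell_sInf_mem J)
  let e : meanSpace 𝕜 I.1 →ₗ[𝕜] 𝕜 :=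
    { toFun := fun h => h.1 (sInf J.1)
      map_add' := fun _ _ => rfl
      map_smul' := fun _ _ => rfl }
  refine Module.Finite.of_injective e ((injective_iff_map_eq_zero e).2 fun h hh => ?_)
  obtain ⟨c, hc⟩ := h.2
  have h1 : h.1 (sInf J.1) = 0 := hh
  rw [hc, indicator_of_mem hx] at h1
  refine Subtype.ext ?_
  rw [hc, h1, indicator_zero]
  rfl

lemma conj_mem_diffSpace {I : L.Cell} {f : ℝ → 𝕜} (hf : f ∈ diffSpace 𝕜 L I.1) :
    (fun x => (starRingEnd 𝕜) (f x)) ∈ diffSpace 𝕜 L I.1 := by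
  have h1 : ∀ J, L.IsChild J I.1 → ∀ x ∈ J, ∀ y ∈ J,
      (starRingEnd 𝕜) (f x) = (starRingEnd 𝕜) (f y) :=
    fun J hJ x hx y hy => by rw [hf.1 J hJ x hx y hy]
  have h2 : ∀ x, (∀ J, L.IsChild J I.1 → x ∉ J) → (starRingEnd 𝕜) (f x) = 0 :=
    fun x hx => by rw [hf.2.1 x hx, map_zero]
  exact ⟨h1, h2, integrable_of_const_on_children h1 h2, by rw [integral_conj, hf.2.2.2, map_zero]⟩

lemma conj_mem_meanSpace {I : Set ℝ} {f : ℝ → 𝕜} (hf : f ∈ meanSpace 𝕜 I) :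
    (fun x => (starRingEnd 𝕜) (f x)) ∈ meanSpace 𝕜 I := by
  obtain ⟨c, rfl⟩ := hf
  exact ⟨(starRingEnd 𝕜) c, by ext x; by_cases hx : x ∈ I <;> simp [hx]⟩

section

variable {q : ℝ} [hq1 : Fact (1 ≤ q)]

lemma ExtHardy.trunc_singleton_congr {z : L.Cell ⊕ L.TopFin} {f f' : Formal 𝕜 L}
    (h : f.comp z = f'.comp z) : ExtHardy.trunc q {z} f = ExtHardy.trunc q {z} f' := by
  refine Subtype.ext (Formal.ext_comp fun y => ?_)
  change (f.trunc {z}).comp y = (f'.trunc {z}).comp y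
  rw [Formal.comp_trunc, Formal.comp_trunc]
  by_cases hy : y = z
  · subst hy; simp [h]
  · simp [hy]

/-- Treats differences and mean terms at once. The section `e` need not be linear, since truncation
to z sees only the component at z. -/
lemma exists_comp_eq (Φ : StrongDual 𝕜 (ExtHardy 𝕜 L q)) (z : L.Cell ⊕ L.TopFin)
    {V : Submodule 𝕜 (ℝ → 𝕜)} [FiniteDimensional 𝕜 V]
    (hconj : ∀ f ∈ V, (fun x => (starRingEnd 𝕜) (f x)) ∈ V)
    (hV : ∀ f : Formal 𝕜 L, f.comp z ∈ V) (e : V → Formal 𝕜 L) (he : ∀ h, (e h).comp z = h.1) :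
    ∃ g ∈ V, ∀ f, Φ (ExtHardy.trunc q {z} f) = ∫ x, f.comp z x * g x := by
  classical
  have hq0 : 0 < q := by linarith [hq1.out]
  have hcomp : ∀ (f : Formal 𝕜 L) y, (ExtHardy.trunc q {z} f).1.comp y =
      if y ∈ ({z} : Finset _) then f.comp y else 0 := fun f y => by
    change (f.trunc {z}).comp y = _
    rw [Formal.comp_trunc]
  let l : V →ₗ[𝕜] 𝕜 :=
    { toFun := fun h => Φ (ExtHardy.trunc q {z} (e h))
      map_add' := fun h h' => by
        rw [← map_add]
        congr 1
        refine Subtype.ext (Formal.ext_comp fun y => ?_)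
        change _ = ((ExtHardy.trunc q {z} (e h)).1 + (ExtHardy.trunc q {z} (e h')).1).comp y
        rw [Formal.comp_add, hcomp, hcomp, hcomp]
        by_cases hy : y = z
        · subst hy; simp [he]
        · simp [hy]
      map_smul' := fun c h => by
        rw [RingHom.id_apply, ← map_smul]
        congr 1
        refine Subtype.ext (Formal.ext_comp fun y => ?_)
        change _ = (c • (ExtHardy.trunc q {z} (e h)).1).comp y
        rw [Formal.comp_smul, hcomp, hcomp]
        by_cases hy : y = z
        · subst hy; simp [he]
        · simp [hy] }
  obtain ⟨g, hg, h⟩ := exists_integral_eq (V := V)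
    (fun f hf g hg => by
      have := (e ⟨f, hf⟩).integrable_comp_mul (e ⟨g, hg⟩) z
      rwa [he, he] at this) hconj
    (fun f hf h0 => by
      have h1 : ((e ⟨f, hf⟩).trunc {z}).hardyENorm q = 0 := by
        rw [Formal.hardyENorm_trunc_singleton hq0, he, ← lintegral_zero]
        refine lintegral_congr_ae ?_
        filter_upwards [h0] with x hx
        simp [hx]
      have h2 := (isENorm_hardy (𝕜 := 𝕜) L hq1.out).eq_zero _ h1
      have h3 : ((e ⟨f, hf⟩).trunc {z}).comp z = 0 := by
        rw [h2]; cases z <;> rfl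
      rwa [Formal.comp_trunc, if_pos (Finset.mem_singleton_self z), he] at h3) l
  refine ⟨g, hg, fun f => ?_⟩
  rw [ExtHardy.trunc_singleton_congr (f' := e ⟨f.comp z, hV f⟩) (he ⟨f.comp z, hV f⟩).symm]
  exact h ⟨f.comp z, hV f⟩

lemma exists_represents (Φ : StrongDual 𝕜 (ExtHardy 𝕜 L q)) : ∃ g : Formal 𝕜 L,
    Represents Φ g := by
  classical
  have h1 : ∀ I : L.Cell, ∃ g ∈ diffSpace 𝕜 L I.1, ∀ f,
      Φ (ExtHardy.trunc q {.inl I} f) = ∫ x, f.comp (.inl I) x * g x := fun I =>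
    exists_comp_eq Φ (.inl I) (fun _ => conj_mem_diffSpace) (fun f => (f.1 I).2)
      (fun h => ((Pi.single I h, 0) :
        (∀ I : L.Cell, diffSpace 𝕜 L I.1) × (∀ I : L.TopFin, meanSpace 𝕜 I.1)))
      (fun h => congrArg Subtype.val (Pi.single_eq_same (M := fun I : L.Cell =>
        diffSpace 𝕜 L I.1) I h))
  have h2 : ∀ I : L.TopFin, ∃ g ∈ meanSpace 𝕜 I.1, ∀ f,
      Φ (ExtHardy.trunc q {.inr I} f) = ∫ x, f.comp (.inr I) x * g x := fun I =>
    exists_comp_eq Φ (.inr I) (fun _ => conj_mem_meanSpace) (fun f => (f.2 I).2)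
      (fun h => ((0, Pi.single I h) :
        (∀ I : L.Cell, diffSpace 𝕜 L I.1) × (∀ I : L.TopFin, meanSpace 𝕜 I.1)))
      (fun h => congrArg Subtype.val (Pi.single_eq_same (M := fun I : L.TopFin =>
        meanSpace 𝕜 I.1) I h))
  choose a ha ha' using h1
  choose b hb hb' using h2
  refine ⟨(fun I => ⟨a I, ha I⟩, fun I => ⟨b I, hb I⟩), ?_⟩
  rintro (I | I) f
  · exact ha' I f
  · exact hb' I f

/-! ### Duality -/

variable {p : ℝ} [Fact (1 ≤ p)]

lemma Represents.exists_extBMO (hpq : q.HolderConjugate p)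
    {Φ : StrongDual 𝕜 (ExtHardy 𝕜 L q)} {g : Formal 𝕜 L} (h : Represents Φ g) :
    ∃ g' : ExtBMO 𝕜 L p, g'.1 = g ∧ pairing 𝕜 L hpq g' = Φ := by
  have hg : g.bmoENorm p < ∞ := (h.bmoENorm_le hpq).trans_lt
    (ENNReal.mul_lt_top (by norm_num) enorm_lt_top)
  exact ⟨⟨g, hg⟩, rfl, (represents_pairing hpq ⟨g, hg⟩).unique h⟩

lemma norm_le_pairing (hpq : q.HolderConjugate p) (g : ExtBMO 𝕜 L p) :
    ‖g‖ ≤ 4 * ‖pairing 𝕜 L hpq g‖ := by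
  have h := (represents_pairing hpq g).bmoENorm_le hpq
  have h1 := ENNReal.toReal_mono (ENNReal.mul_ne_top (by norm_num) enorm_ne_top) h
  rwa [ENNReal.toReal_mul, toReal_enorm, ENNReal.toReal_ofNat] at h1

/-- The projection that drops the mean terms. -/
def dropMean : ExtHardy 𝕜 L q →L[𝕜] Hardy 𝕜 L q :=
  LinearMap.mkContinuous
    { toFun := fun f => ⟨⟨(f.1.1, 0), by
          have hq0 : 0 < q := by linarith [hq1.out]
          refine lt_of_le_of_lt ?_ (ExtHardy.hardyENorm_ne_top f).lt_top
          refine lintegral_mono fun x => ENNReal.rpow_le_rpow ?_ (by positivity)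
          refine add_le_add le_rfl (ENNReal.tsum_le_tsum fun I => ?_)
          change ‖(0 : 𝕜)‖ₑ ^ q ≤ _
          simp [hq0]⟩, fun _ => rfl⟩
      map_add' := fun f f' => Subtype.ext <| Subtype.ext <| Formal.ext (fun _ => rfl) fun _ =>
        (add_zero (0 : ℝ → 𝕜)).symm
      map_smul' := fun c f => Subtype.ext <| Subtype.ext <| Formal.ext (fun _ => rfl) fun _ =>
        (smul_zero c : c • (0 : ℝ → 𝕜) = 0).symm } 1 fun f => by
    have hq0 : 0 < q := by linarith [hq1.out]
    rw [one_mul]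
    refine ENNReal.toReal_mono (ExtHardy.hardyENorm_ne_top f) ?_
    refine lintegral_mono fun x => ENNReal.rpow_le_rpow ?_ (by positivity)
    refine add_le_add le_rfl (ENNReal.tsum_le_tsum fun I => ?_)
    change ‖(0 : 𝕜)‖ₑ ^ q ≤ _
    simp [hq0]

lemma norm_dropMean_le : ‖(dropMean : ExtHardy 𝕜 L q →L[𝕜] Hardy 𝕜 L q)‖ ≤ 1 :=
  LinearMap.mkContinuous_norm_le _ zero_le_one _

lemma dropMean_coe (f : Hardy 𝕜 L q) : dropMean f.1 = f :=
  Subtype.ext <| Subtype.ext <| Formal.ext (fun _ => rfl) fun I => (f.2 I).symm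

lemma pairing_dropMean (hpq : q.HolderConjugate p) (g : BMO 𝕜 L p) (f : ExtHardy 𝕜 L q) :
    pairing 𝕜 L hpq g.1 (dropMean f).1 = pairing 𝕜 L hpq g.1 f := by
  rw [pairing_apply, pairing_apply]
  refine tsum_congr fun z => ?_
  rcases z with I | I
  · rfl
  · have : g.1.1.mean I = 0 := g.2 I
    simp [this]

/-- Ψ is extended to the larger space by composing with the projection; the extension kills all mean
components, so it is represented by a decomposition without mean terms. -/
lemma exists_bmo (hpq : q.HolderConjugate p) (Ψ : StrongDual 𝕜 (Hardy 𝕜 L q)) :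
    ∃ g : BMO 𝕜 L p, (pairing 𝕜 L hpq g.1).comp (Hardy 𝕜 L q).subtypeL = Ψ := by
  obtain ⟨g, hg⟩ := exists_represents (Ψ.comp (dropMean (q := q) (L := L)))
  -- The mean part of the representing decomposition may be replaced by 0.
  have hg' : Represents (Ψ.comp dropMean) (𝕜 := 𝕜) (L := L) (q := q) (g.1, 0) := by
    rintro (I | I) f
    · exact hg (.inl I) f
    · have h1 : dropMean (ExtHardy.trunc q {.inr I} f) = 0 :=
        Subtype.ext <| Subtype.ext <| Formal.ext (fun J => by
          refine (Formal.comp_trunc {.inr I} f (.inl J)).trans ?_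
          simp) fun _ => rfl
      rw [ContinuousLinearMap.comp_apply, h1, map_zero]
      symm
      refine integral_eq_zero_of_ae (Filter.Eventually.of_forall fun x => ?_)
      exact mul_zero _
  obtain ⟨g', hg1, hg2⟩ := hg'.exists_extBMO hpq
  refine ⟨⟨g', fun I => by rw [Submodule.subtype_apply, hg1]; rfl⟩, ?_⟩
  ext f
  change pairing 𝕜 L hpq g' f.1 = Ψ f
  rw [hg2, ContinuousLinearMap.comp_apply, dropMean_coe]

end

/-! ### From two-sided bounds to isomorphisms, and the theorem -/

lemma exists_equiv_of_bounds {E F : Type*} [NormedAddCommGroup E] [NormedSpace 𝕜 E]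
    [NormedAddCommGroup F] [NormedSpace 𝕜 F] (B : E →ₗ[𝕜] F) {C : ℝ} (hC : 0 < C)
    (h1 : ∀ g, ‖B g‖ ≤ C * ‖g‖) (h2 : ∀ g, ‖g‖ ≤ C * ‖B g‖) (hs : Function.Surjective B) :
    ∃ Φ : E ≃L[𝕜] F, (∀ g, Φ g = B g) ∧ ∀ g, C⁻¹ * ‖g‖ ≤ ‖Φ g‖ ∧ ‖Φ g‖ ≤ C * ‖g‖ := by
  have hinj : Function.Injective B := (injective_iff_map_eq_zero B).2 fun g hg => by
    have := h2 g
    rw [hg, norm_zero, mul_zero] at this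
    exact norm_le_zero_iff.1 this
  let e := LinearEquiv.ofBijective B ⟨hinj, hs⟩
  refine ⟨e.toContinuousLinearEquivOfBounds C C h1 fun y => ?_, fun g => rfl, fun g => ⟨?_, h1 g⟩⟩
  · obtain ⟨g, rfl⟩ := e.surjective y
    rw [e.symm_apply_apply]
    exact h2 g
  · rw [inv_mul_le_iff₀ hC]
    exact h2 g

end MartingaleBMO

end

open MartingaleBMO in
theorem mainTheorem9 (𝕜 : Type*) [RCLike 𝕜] (q q' : ℝ) [Fact (1 ≤ q)] [Fact (1 ≤ q')]
    (hq : 1 < q) (hqq : 1 / q + 1 / q' = 1) :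
    ∃ C : ℝ, 0 < C ∧ ∀ (X : Set ℝ), X.OrdConnected → X.Nonempty → ∀ L : IntervalLattice X,
      (∃ Φ : BMO 𝕜 L q' ≃L[𝕜] StrongDual 𝕜 (Hardy 𝕜 L q),
        (∀ (g : BMO 𝕜 L q') (f : Hardy 𝕜 L q), HasPairing f.1.1 g.1.1 (Φ g f)) ∧
        ∀ g : BMO 𝕜 L q', C⁻¹ * ‖g‖ ≤ ‖Φ g‖ ∧ ‖Φ g‖ ≤ C * ‖g‖) ∧
      (∃ Φ : ExtBMO 𝕜 L q' ≃L[𝕜] StrongDual 𝕜 (ExtHardy 𝕜 L q),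
        (∀ (g : ExtBMO 𝕜 L q') (f : ExtHardy 𝕜 L q), HasPairing f.1 g.1 (Φ g f)) ∧
        ∀ g : ExtBMO 𝕜 L q', C⁻¹ * ‖g‖ ≤ ‖Φ g‖ ∧ ‖Φ g‖ ≤ C * ‖g‖) := by
  have hpq : q.HolderConjugate q' :=
    Real.holderConjugate_iff.2 ⟨hq, by rwa [one_div, one_div] at hqq⟩
  -- The upper bound holds with 5 and the lower one with 4, so 5 serves for both.
  refine ⟨5, by norm_num, fun X _ _ L => ⟨?_, ?_⟩⟩
  · let B : BMO 𝕜 L q' →ₗ[𝕜] StrongDual 𝕜 (Hardy 𝕜 L q) :=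
      { toFun := fun g => (pairing 𝕜 L hpq g.1).comp (Hardy 𝕜 L q).subtypeL
        map_add' := fun g g' => by ext f; simp
        map_smul' := fun c g => by ext f; simp }
    have hB : ∀ g, (B g).comp dropMean = pairing 𝕜 L hpq g.1 := fun g => by
      ext f
      exact pairing_dropMean hpq g f
    obtain ⟨Φ, hΦ, hb⟩ := exists_equiv_of_bounds (𝕜 := 𝕜) (E := BMO 𝕜 L q')
      (F := StrongDual 𝕜 (Hardy 𝕜 L q)) B (C := 5) (by norm_num)
      (fun g => by
        refine ContinuousLinearMap.opNorm_le_bound _ (by positivity) fun f => ?_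
        exact ((pairing 𝕜 L hpq g.1).le_opNorm f.1).trans
          (mul_le_mul_of_nonneg_right (norm_pairing_le hpq g.1) (norm_nonneg _)))
      (fun g => by
        have h1 := norm_le_pairing hpq g.1
        -- Restricting to the subspace without mean terms loses no norm: the full functional factors
        -- through the projection, which has norm at most 1.
        have h2 : ‖pairing 𝕜 L hpq g.1‖ ≤ ‖B g‖ := by
          rw [← hB g]
          exact ((B g).opNorm_comp_le _).trans
            (mul_le_of_le_one_right (norm_nonneg _) norm_dropMean_le)
        refine h1.trans ?_
        linarith [norm_nonneg (B g)])
      (fun Ψ => exists_bmo hpq Ψ)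
    refine ⟨Φ, fun g f => ?_, hb⟩
    rw [hΦ]
    exact hasPairing_pairing hpq g.1 f.1
  · obtain ⟨Φ, hΦ, hb⟩ := exists_equiv_of_bounds (pairing 𝕜 L hpq).toLinearMap (C := 5)
      (by norm_num) (norm_pairing_le hpq)
      (fun g => (norm_le_pairing hpq g).trans
        (mul_le_mul_of_nonneg_right (by norm_num) (norm_nonneg _)))
      (fun Ψ => by
        obtain ⟨g, hg⟩ := exists_represents Ψ
        obtain ⟨g', -, hg'⟩ := hg.exists_extBMO hpq
        exact ⟨g', hg'⟩)
    refine ⟨Φ, fun g f => ?_, hb⟩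
    rw [hΦ]
    exact hasPairing_pairing hpq g f
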